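/- **Quantum Holant Theorem.** Let $q\ge 1$. A \emph{signature} of arity $n$ and domain $[q]$ is a tensor $F\in\mathbb C^{[q]^n}$; its \emph{signature vector} is $f=(F_{x_1\cdots x_n})_{x\in[q]^n}$. Let $\mathcal U=(u_{ij})$ be a $q\times q$ \emph{quantum permutation matrix}: its entries lie in a nonzero unital $C^*$-algebra $A$, $u_{ij}^2=u_{ij}=u_{ij}^*$ for all $i,j$, and $\sum_j u_{ij}=\sum_i u_{ij}=1$. Let $\mathcal U^{\otimes n}$ be the $q^n\times q^n$ matrix with entries $(\mathcal U^{\otimes n})_{x,y}=u_{x_1y_1}u_{x_2y_2}\cdots u_{x_ny_n}$, and identify $\alpha\in\mathbb C$ with $\alpha 1\in A$. Let $\mathcal F=\{F_i\}_{i\in I}$ be a set of signatures with domain $[q]$, $F_i$ of arity $n_i$, such that every $\mathcal U^{\otimes n_i}f_i$ has entries in $\mathbb C$, and let $\mathcal G=\mathcal U\mathcal F=\{G_i\}_{i\in I}$, where $G_i$ is the signature of arity $n_i$ with signature vector $g_i=\mathcal U^{\otimes n_i}f_i$. Assume that $\mathcal F$ and $\mathcal U\mathcal F$ are compatible conjugate-closed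 sets: each of them contains a signature if and only if it contains its entrywise conjugate, and $F_i=\overline{F_j}\iff G_i=\overline{G_j}$ for all $i,j\in I$. A \emph{signature grid} $\Omega$ for $\mathcal F$ is a finite multigraph $(V,E)$ (parallel edges and loops allowed, a loop counting twice in the degree) in which every vertex $v$ is assigned some $F_v\in\mathcal F$ of arity $\deg(v)$, and the edge ends at $v$ are labeled bijectively, $e^v_1,\dots,e^v_{\deg(v)}$, as the inputs of $F_v$. Its Holant value is $$\mathrm{Holant}_\Omega(\mathcal F)=\sum_{\sigma:E\to[q]}\ \prod_{v\in V}F_v\bigl(\sigma(e^v_1),\dots,\sigma(e^v_{\deg(v)})\bigr).$$ The grid is \emph{planar} if its multigraph has an embedding in the plane without crossing edges such that, around every vertex $v$, the edge ends $e^v_1,\dots,e^v_{\deg(v)}$ are in cyclic order, either counterclockwise or clockwise (the direction may depend on $v$). Then for every planar signature grid $\Omega$ for $\mathcal F$, $$\mathrm{Holant}_{\Omega}(\mathcal F)=\mathrm{Holant}_{\Omega'}(\mathcal U\mathcal F),$$ where $\Omega'$ is obtained from $\Omega$ by replacing every signature $F_i\in\mathcal F$ by the corresponding signature $G_i\in\mathcal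 U\mathcal F$. -/

import Mathlib

namespace QuantumHolant

open scoped Matrix

/-- A signature (constraint function) of domain size `q` and arity `n`: a tensor in `ℂ^([q]^n)`. -/
abbrev Signature (q n : ℕ) : Type := (Fin n → Fin q) → ℂ

/-- The entrywise complex conjugate of a signature. -/
def Signature.conj {q n : ℕ} (F : Signature q n) : Signature q n :=
  fun x => starRingEnd ℂ (F x)

/-- The set of signatures underlying an indexed family; a member of the set is a signature together
with its arity. -/
def signatureSet {ι : Type*} {q : ℕ} {n : ι → ℕ} (F : ∀ i, Signature q (n i)) :
    Set (Σ k : ℕ, Signature q k) :=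
  Set.range fun i => ⟨n i, F i⟩

/-- A set of signatures is conjugate closed: `F` belongs to it iff its conjugate does. -/
def IsConjClosed {q : ℕ} (S : Set (Σ k : ℕ, Signature q k)) : Prop :=
  ∀ (k : ℕ) (F : Signature q k), (⟨k, F⟩ : Σ k : ℕ, Signature q k) ∈ S ↔
    (⟨k, F.conj⟩ : Σ k : ℕ, Signature q k) ∈ S

/-- Two families of signatures (with equal domain, and equal arity at equal indices, as forced by
the types) are compatible conjugate-closed sets: both are conjugate closed, and
`F i` is the conjugate of `F j` exactly when `G i` is the conjugate of `G j`. -/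
structure CompatibleConjClosed {ι : Type*} {q : ℕ} {n : ι → ℕ}
    (F G : ∀ i, Signature q (n i)) : Prop where
  left_closed : IsConjClosed (signatureSet F)
  right_closed : IsConjClosed (signatureSet G)
  conj_iff : ∀ i j,
    (⟨n i, F i⟩ : Σ k : ℕ, Signature q k) = ⟨n j, (F j).conj⟩ ↔
      (⟨n i, G i⟩ : Σ k : ℕ, Signature q k) = ⟨n j, (G j).conj⟩

/-- A quantum permutation matrix: every entry is a projector (self-adjoint idempotent), and every
row and every column sums to the unit. -/
structure IsQuantumPermutation {A : Type*} [CStarAlgebra A] {q : ℕ}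
    (U : Matrix (Fin q) (Fin q) A) : Prop where
  idempotent : ∀ i j, U i j * U i j = U i j
  selfAdjoint : ∀ i j, star (U i j) = U i j
  row_sum : ∀ i, ∑ j, U i j = 1
  col_sum : ∀ j, ∑ i, U i j = 1

/-- The Kronecker power `U^{⊗ n}`, whose `(x, y)` entry is the product
`U (x 0) (y 0) * U (x 1) (y 1) * ⋯ * U (x (n - 1)) (y (n - 1))` in this order. -/
def tensorPower {A : Type*} [Ring A] {q : ℕ} (U : Matrix (Fin q) (Fin q) A) (n : ℕ) :
    Matrix (Fin n → Fin q) (Fin n → Fin q) A :=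
  Matrix.of fun x y => (List.ofFn fun k => U (x k) (y k)).prod

/-- The signature vector of `F`, with each complex entry `α` read as the multiple `α • 1` of the
unit of the algebra. -/
noncomputable def Signature.vec (A : Type*) [CStarAlgebra A] {q n : ℕ} (F : Signature q n) :
    (Fin n → Fin q) → A :=
  fun x => algebraMap ℂ A (F x)

/-- `G = U F`: the family `G` of complex-valued signatures is obtained from the family `F` by
replacing every signature vector `f`, of arity `n`, by `U^{⊗ n} f`. -/
def IsTransform {A : Type*} [CStarAlgebra A] {q : ℕ} (U : Matrix (Fin q) (Fin q) A)
    {ι : Type*} {n : ι → ℕ} (F G : ∀ i, Signature q (n i)) : Prop :=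
  ∀ i, tensorPower U (n i) *ᵥ (F i).vec A = (G i).vec A

/-- A signature grid over signatures indexed by `ι`, the `i`-th one having arity `n i`: a
multigraph with vertex set `V` and edge set `E` (parallel edges and loops allowed), every vertex
`v` being assigned the signature with index `lab v`, and the edge ends at `v` being matched
bijectively with the inputs of that signature. The two ends of the edge `e` are
`(e, false)` and `(e, true)`; if `slot (e, b) = ⟨v, k⟩` then this end of `e` is attached to
the vertex `v` as the `k`-th input of its signature. -/
structure SignatureGrid {ι : Type*} (n : ι → ℕ) (V E : Type*) where
  lab : V → ι
  slot : E × Bool ≃ Σ v : V, Fin (n (lab v))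

namespace SignatureGrid

variable {ι : Type*} {n : ι → ℕ} {V E : Type*}

/-- The edge that is the `k`-th input of the signature at `v`. -/
def edgeAt (Ω : SignatureGrid n V E) (v : V) (k : Fin (n (Ω.lab v))) : E :=
  (Ω.slot.symm ⟨v, k⟩).1

/-- The Holant value of the grid, with the signature `F i` at the vertices with index `i`. -/
def holant [Fintype V] [Fintype E] [DecidableEq E] {q : ℕ}
    (Ω : SignatureGrid n V E) (F : ∀ i, Signature q (n i)) : ℂ :=
  ∑ σ : E → Fin q, ∏ v : V, F (Ω.lab v) fun k => σ (Ω.edgeAt v k)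

/-- The involution of the edge ends (indexed by the inputs that they are attached to) that
exchanges the two ends of every edge. -/
def mate (Ω : SignatureGrid n V E) : Equiv.Perm (Σ v : V, Fin (n (Ω.lab v))) :=
  (Ω.slot.symm.trans ((Equiv.refl E).prodCongr Equiv.boolNot)).trans Ω.slot

/-- The rotation system in which the inputs of the signature at `v` are listed in counterclockwise
cyclic order if `ccw v = true`, and in clockwise cyclic order otherwise: it sends every edge end
at `v` to the next one at `v` in counterclockwise order. -/
def rotation (Ω : SignatureGrid n V E) (ccw : V → Bool) :
    Equiv.Perm (Σ v : V, Fin (n (Ω.lab v))) :=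
  Equiv.Perm.sigmaCongrRight fun v =>
    if ccw v then finRotate (n (Ω.lab v)) else (finRotate (n (Ω.lab v)))⁻¹

end SignatureGrid

/-- Euler's formula `V - E + F = 2 C` for the combinatorial map on the set `D` of edge ends with
vertex rotation `ρ` and edge involution `τ`. Vertices, edges and faces are the orbits of
`ρ`, of `τ` and of `ρ * τ`, and connected components are the classes of the equivalence relation
generated by the orbits of `ρ` and `τ`. Equivalently, every connected component of the
embedding described by `ρ` and `τ` has genus 0, that is, it is an embedding in the plane. -/
def IsPlanarMap {D : Type*} (ρ τ : Equiv.Perm D) : Prop :=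
  (Nat.card (Quotient (Equiv.Perm.SameCycle.setoid ρ)) : ℤ)
      - Nat.card (Quotient (Equiv.Perm.SameCycle.setoid τ))
      + Nat.card (Quotient (Equiv.Perm.SameCycle.setoid (ρ * τ)))
    = 2 * Nat.card (Quotient
        (Equiv.Perm.SameCycle.setoid ρ ⊔ Equiv.Perm.SameCycle.setoid τ))

/-- The grid is planar: its multigraph has an embedding in the plane (a rotation system of genus 0)
such that around every vertex the inputs of its signature are in cyclic order, each vertex
being free to be oriented counterclockwise or clockwise. -/
def SignatureGrid.IsPlanar {ι : Type*} {n : ι → ℕ} {V E : Type*}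
    (Ω : SignatureGrid n V E) : Prop :=
  ∃ ccw : V → Bool, IsPlanarMap (Ω.rotation ccw) Ω.mate

end QuantumHolant

/-! Entries of `U` need not commute, so the order of the factors in `U^{⊗n}` must be tracked. Write
the inputs of a tensor as a word. For scalar tensors the relation "`U` along the word `w` sends `F`
to `G`" (`Transforms`) survives exactly the operations that a plane drawing supplies: cyclic shift
of the word (`Transforms.rotate`), concatenation of disjoint words (`Transforms.mul`), contraction
of two adjacent inputs (`Transforms.contract`), and insertion or deletion of inputs on which `F`
does not depend (`Transforms.remove`). A vertex drawn clockwise needs the reversed word; adjoints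
reverse products, and conjugate closure turns the adjoint relation back into one about `F` and `G`
(`IsTransform.sum_reverse_eq`).

Planarity is used only as the inequality `HasEulerBound`. An edge between distinct vertices is
contracted, which merges their cyclic words and keeps the inequality. Once every edge is a loop,
counting orbits produces an innermost loop (`HasEulerBound.exists_innermost`); its ends are adjacent
up to irrelevant inputs, so it can be contracted too. Each step eliminates one edge on both sides
simultaneously and multiplies both totals by the same factor `q ^ 2`. When no edge is left all
tensors are constants, `U` acts on them trivially, and left and right agree.

The set `D` of edge ends never changes: ends of eliminated edges stay as fixed points of the
involution ("dead" ends, as opposed to "live" ones), and tensors no longer depend on them. -/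

namespace QuantumHolant

open Equiv.Perm

/-! ### Orbits of permutations and Euler's inequality for combinatorial maps. -/

section Orbits

variable {D : Type*}

/-- The number of orbits of a permutation. -/
noncomputable def orbitCount (p : Equiv.Perm D) : ℕ :=
  Nat.card (Quotient (SameCycle.setoid p))

theorem setoid_le_of_forall_apply {p : Equiv.Perm D} {s : Setoid D} [Finite D]
    (h : ∀ x, s x (p x)) : SameCycle.setoid p ≤ s := by
  intro x y hxy
  obtain ⟨k, rfl⟩ := SameCycle.exists_nat_pow_eq hxy
  induction k with
  | zero => exact s.refl' x
  | succ k ih =>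
    rw [pow_succ', Equiv.Perm.mul_apply]
    exact s.trans' (ih ⟨k, by simp⟩) (h _)

theorem setoid_mul_le [Finite D] (p r : Equiv.Perm D) :
    SameCycle.setoid (p * r) ≤ SameCycle.setoid p ⊔ SameCycle.setoid r := by
  refine setoid_le_of_forall_apply fun x => ?_
  have h1 : (SameCycle.setoid p ⊔ SameCycle.setoid r) x (r x) :=
    (le_sup_right : SameCycle.setoid r ≤ _) (sameCycle_apply_right.2 (SameCycle.refl r x))
  have h2 : (SameCycle.setoid p ⊔ SameCycle.setoid r) (r x) (p (r x)) :=
    (le_sup_left : SameCycle.setoid p ≤ _) (sameCycle_apply_right.2 (SameCycle.refl p (r x)))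
  exact Setoid.trans' _ h1 h2

theorem setoid_swap_le [DecidableEq D] [Finite D] {s : Setoid D} {a b : D} (h : s a b) :
    SameCycle.setoid (Equiv.swap a b) ≤ s := by
  refine setoid_le_of_forall_apply fun x => ?_
  by_cases ha : x = a
  · subst ha; simpa using h
  by_cases hb : x = b
  · subst hb; simpa using s.symm' h
  rw [Equiv.swap_apply_of_ne_of_ne ha hb]

/-- From `a` the new permutation jumps to `p b` and then follows the `p`-orbit of `b`. It meets
neither `a`, which lies in another orbit, nor `b` before a full period `n`, so it arrives at `b`
after `n` steps. -/
theorem sameCycle_mul_swap [DecidableEq D] [Finite D] {p : Equiv.Perm D} {a b : D}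
    (h : ¬ SameCycle p a b) : SameCycle (p * Equiv.swap a b) a b := by
  classical
  have hex : ∃ n, 0 < n ∧ (p ^ n) b = b :=
    ⟨orderOf p, orderOf_pos p, by rw [pow_orderOf_eq_one]; rfl⟩
  have hmin := fun m => @Nat.find_min _ _ hex m
  obtain ⟨hpos, hn⟩ := Nat.find_spec hex
  set n := Nat.find hex
  have key : ∀ k, k + 1 ≤ n → ((p * Equiv.swap a b) ^ (k + 1)) a = (p ^ (k + 1)) b := by
    intro k
    induction k with
    | zero => intro _; simp
    | succ k ih =>
      intro hk
      rw [pow_succ', Equiv.Perm.mul_apply, ih (by omega), pow_succ' p (k + 1),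
        Equiv.Perm.mul_apply, Equiv.Perm.mul_apply, Equiv.swap_apply_of_ne_of_ne]
      · intro hc
        exact h (SameCycle.symm ⟨(k + 1 : ℕ), by rw [zpow_natCast]; exact hc⟩)
      · intro hc
        exact hmin (k + 1) (by omega) ⟨by omega, hc⟩
  refine ⟨n, ?_⟩
  obtain ⟨m, hm⟩ : ∃ m, n = m + 1 := ⟨n - 1, by omega⟩
  rw [zpow_natCast, hm, key m (by omega), ← hm, hn]

theorem setoid_mul_swap [DecidableEq D] [Finite D] {p : Equiv.Perm D} {a b : D}
    (h : ¬ SameCycle p a b) :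
    SameCycle.setoid (p * Equiv.swap a b)
      = SameCycle.setoid p ⊔ SameCycle.setoid (Equiv.swap a b) := by
  have h1 : SameCycle.setoid (Equiv.swap a b) ≤ SameCycle.setoid (p * Equiv.swap a b) :=
    setoid_swap_le (sameCycle_mul_swap h)
  refine le_antisymm (setoid_mul_le _ _) (sup_le ?_ h1)
  have h2 := setoid_mul_le (p * Equiv.swap a b) (Equiv.swap a b)
  rw [mul_assoc, Equiv.swap_mul_self, mul_one] at h2
  exact h2.trans (sup_le le_rfl h1)

/-- The map `g` redirects the class of `b` to that of `a`. Its kernel is the join, and its range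
misses precisely the class of `b`. -/
theorem card_quotient_sup_swap [DecidableEq D] [Finite D] {s : Setoid D} {a b : D}
    (h : ¬ s a b) :
    Nat.card (Quotient (s ⊔ SameCycle.setoid (Equiv.swap a b))) + 1 = Nat.card (Quotient s) := by
  classical
  let g : D → Quotient s := fun x => if s x b then Quotient.mk s a else Quotient.mk s x
  have hg : s ⊔ SameCycle.setoid (Equiv.swap a b) = Setoid.ker g := by
    apply le_antisymm
    · refine sup_le ?_ (setoid_swap_le ?_)
      · intro x y hxy
        change g x = g y
        have : s x b ↔ s y b := ⟨s.trans' (s.symm' hxy), s.trans' hxy⟩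
        simp only [g, this]
        split_ifs
        · rfl
        · exact Quotient.sound hxy
      · change g a = g b
        simp [g]
    · intro x y hxy
      have hl : s ≤ s ⊔ SameCycle.setoid (Equiv.swap a b) := le_sup_left
      have hab : (s ⊔ SameCycle.setoid (Equiv.swap a b)) b a :=
        (le_sup_right : SameCycle.setoid (Equiv.swap a b) ≤ _)
          ⟨1, by simp⟩
      have hgx : ∀ x, ∃ c, g x = Quotient.mk s c ∧
          (s ⊔ SameCycle.setoid (Equiv.swap a b)) x c := by
        intro x
        by_cases hx : s x b
        · exact ⟨a, by simp [g, hx], Setoid.trans' _ (hl hx) hab⟩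
        · exact ⟨x, by simp [g, hx], Setoid.refl' _ x⟩
      obtain ⟨c, hc, hc'⟩ := hgx x
      obtain ⟨d, hd, hd'⟩ := hgx y
      have hcd : s c d := Quotient.exact (hc.symm.trans (Eq.trans hxy hd))
      exact Setoid.trans' _ hc' (Setoid.trans' _ (hl hcd) (Setoid.symm' _ hd'))
  have hr : Set.range g = {Quotient.mk s b}ᶜ := by
    ext c
    constructor
    · rintro ⟨x, rfl⟩ hc
      by_cases hx : s x b
      · simp only [g, hx, if_true, Set.mem_singleton_iff] at hc
        exact h (Quotient.exact hc)
      · simp only [g, hx, if_false, Set.mem_singleton_iff] at hc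
        exact hx (Quotient.exact hc)
    · induction c using Quotient.inductionOn with
      | h x =>
        intro hc
        refine ⟨x, ?_⟩
        have : ¬ s x b := fun hx => hc (Quotient.sound hx)
        simp [g, this]
  rw [hg, Nat.card_congr (Setoid.quotientKerEquivRange g), Nat.card_coe_set_eq, hr,
    Set.ncard_compl, Set.ncard_singleton]
  have : 0 < Nat.card (Quotient s) := Nat.card_pos_iff.2 ⟨⟨Quotient.mk s a⟩, inferInstance⟩
  omega

theorem orbitCount_mul_swap [DecidableEq D] [Finite D] {p : Equiv.Perm D} {a b : D}
    (h : ¬ SameCycle p a b) : orbitCount (p * Equiv.swap a b) + 1 = orbitCount p := by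
  rw [orbitCount, setoid_mul_swap h]
  exact card_quotient_sup_swap h

/-- The Euler characteristic of the combinatorial map of `ρ` and `τ` is at least that of a disjoint
union of spheres. Fixed points of `τ` are permitted. -/
def HasEulerBound (ρ τ : Equiv.Perm D) : Prop :=
  Nat.card D + 2 * Nat.card (Quotient (SameCycle.setoid ρ ⊔ SameCycle.setoid τ))
    ≤ orbitCount ρ + orbitCount τ + orbitCount (ρ * τ)

section Involution

variable [DecidableEq D] {ρ τ : Equiv.Perm D} {d : D}

theorem swap_mul_involutive (hτ : Function.Involutive τ) (d : D) :
    Equiv.swap d (τ d) * τ = τ * Equiv.swap d (τ d) := by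
  ext x
  simp only [Equiv.Perm.mul_apply]
  by_cases h1 : x = d
  · subst h1; simp [hτ x]
  by_cases h2 : x = τ d
  · rw [h2, hτ d, Equiv.swap_apply_left, Equiv.swap_apply_right]
  rw [Equiv.swap_apply_of_ne_of_ne h1 h2, Equiv.swap_apply_of_ne_of_ne]
  · intro h; exact h2 (by rw [← h, hτ x])
  · intro h; exact h1 (τ.injective h)

/-- The involution obtained from `τ` by making `d` and `τ d` fixed points. -/
def detach (τ : Equiv.Perm D) (d : D) : Equiv.Perm D := Equiv.swap d (τ d) * τ

theorem detach_apply_self (τ : Equiv.Perm D) (d : D) : detach τ d d = d := by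
  simp [detach]

theorem detach_apply_apply (hτ : Function.Involutive τ) (d : D) : detach τ d (τ d) = τ d := by
  simp [detach, hτ d]

theorem detach_apply_of_ne (hτ : Function.Involutive τ) {x : D} (h1 : x ≠ d) (h2 : x ≠ τ d) :
    detach τ d x = τ x := by
  rw [detach, Equiv.Perm.mul_apply, Equiv.swap_apply_of_ne_of_ne]
  · intro h; exact h2 (by rw [← h, hτ x])
  · intro h; exact h1 (τ.injective h)

theorem detach_involutive (hτ : Function.Involutive τ) (d : D) :
    Function.Involutive (detach τ d) := by
  intro x
  by_cases h1 : x = d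
  · subst h1; simp [detach_apply_self]
  by_cases h2 : x = τ d
  · subst h2; simp [detach_apply_apply hτ]
  rw [detach_apply_of_ne hτ h1 h2, detach_apply_of_ne hτ, hτ x]
  · intro h; exact h2 (by rw [← h, hτ x])
  · intro h; exact h1 (τ.injective h)

theorem detach_mul_swap (hτ : Function.Involutive τ) (d : D) :
    detach τ d * Equiv.swap d (τ d) = τ := by
  rw [detach, swap_mul_involutive hτ, mul_assoc, Equiv.swap_mul_self, mul_one]

theorem not_sameCycle_detach (hd : τ d ≠ d) : ¬ SameCycle (detach τ d) d (τ d) := by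
  rintro ⟨k, hk⟩
  rw [Equiv.Perm.zpow_apply_eq_self_of_apply_eq_self (detach_apply_self τ d)] at hk
  exact hd hk.symm

variable [Finite D]

theorem orbitCount_detach (hτ : Function.Involutive τ) (hd : τ d ≠ d) :
    orbitCount (detach τ d) = orbitCount τ + 1 := by
  rw [← orbitCount_mul_swap (not_sameCycle_detach hd), detach_mul_swap hτ]

theorem setoid_eq_detach_sup (hτ : Function.Involutive τ) (hd : τ d ≠ d) :
    SameCycle.setoid τ
      = SameCycle.setoid (detach τ d) ⊔ SameCycle.setoid (Equiv.swap d (τ d)) := by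
  rw [← setoid_mul_swap (not_sameCycle_detach hd), detach_mul_swap hτ]

/-- One vertex is lost and `τ` gains one orbit. Faces are unchanged because the two transpositions
cancel in the product, and components are unchanged because both joins contain the pair `d`, `τ d`.
-/
theorem HasEulerBound.contract (h : HasEulerBound ρ τ) (hτ : Function.Involutive τ)
    (hd : ¬ SameCycle ρ d (τ d)) :
    HasEulerBound (ρ * Equiv.swap d (τ d)) (detach τ d) := by
  have hd' : τ d ≠ d := fun h => hd (by rw [h])
  have h1 := orbitCount_mul_swap hd
  have h2 := orbitCount_detach hτ hd'
  have h3 : ρ * Equiv.swap d (τ d) * detach τ d = ρ * τ := by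
    rw [detach, mul_assoc, ← mul_assoc (Equiv.swap _ _), Equiv.swap_mul_self, one_mul]
  have h4 : SameCycle.setoid (ρ * Equiv.swap d (τ d)) ⊔ SameCycle.setoid (detach τ d)
      = SameCycle.setoid ρ ⊔ SameCycle.setoid τ := by
    rw [setoid_mul_swap hd, setoid_eq_detach_sup hτ hd', sup_assoc,
      sup_comm (SameCycle.setoid (Equiv.swap d (τ d)))]
  unfold HasEulerBound at h ⊢
  rw [h3, h4]
  omega

/-- Two faces merge, which offsets the new orbit of `τ`. Components are unchanged because `ρ` alone
already connects the ends of the loop. -/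
theorem HasEulerBound.removeLoop (h : HasEulerBound ρ τ) (hτ : Function.Involutive τ)
    (hd : τ d ≠ d) (hρ : SameCycle ρ d (τ d)) (hφ : ¬ SameCycle (ρ * τ) d (τ d)) :
    HasEulerBound ρ (detach τ d) := by
  have h1 := orbitCount_mul_swap hφ
  have h2 := orbitCount_detach hτ hd
  have h3 : ρ * detach τ d = ρ * τ * Equiv.swap d (τ d) := by
    rw [detach, swap_mul_involutive hτ, mul_assoc]
  have h4 : SameCycle.setoid ρ ⊔ SameCycle.setoid τ
      = SameCycle.setoid ρ ⊔ SameCycle.setoid (detach τ d) := by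
    rw [setoid_eq_detach_sup hτ hd, sup_comm (SameCycle.setoid (detach τ d)), ← sup_assoc,
      sup_eq_left.2 (setoid_swap_le (s := SameCycle.setoid ρ) hρ)]
  unfold HasEulerBound at h ⊢
  rw [h3, ← h4]
  omega

end Involution

/-- Where `τ` is the identity, `ρ * τ` and `ρ` agree; hence a face without live ends is a whole
vertex orbit. -/
theorem sameCycle_of_fixed_on_orbit [Finite D] {ρ τ : Equiv.Perm D} {x y : D}
    (hx : ∀ z, SameCycle (ρ * τ) x z → τ z = z) (h : SameCycle ρ x y) :
    SameCycle (ρ * τ) x y := by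
  obtain ⟨k, rfl⟩ := SameCycle.exists_nat_pow_eq h
  clear h
  induction k with
  | zero => exact SameCycle.refl _ _
  | succ k ih =>
    have h1 : (ρ * τ) ((ρ ^ k) x) = (ρ ^ (k + 1)) x := by
      rw [Equiv.Perm.mul_apply, hx _ ih, pow_succ', Equiv.Perm.mul_apply]
    rw [← h1]
    exact sameCycle_apply_right.2 ih

/-- If all edges of a map of genus zero are loops, some loop is innermost. -/
theorem HasEulerBound.exists_innermost [DecidableEq D] [Fintype D] {ρ τ : Equiv.Perm D}
    (h : HasEulerBound ρ τ) (hτ : Function.Involutive τ) (hloop : ∀ x, SameCycle ρ x (τ x))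
    (hne : ∃ x, τ x ≠ x) :
    ∃ d, τ d ≠ d ∧ ∀ e, τ e ≠ e → SameCycle (ρ * τ) d e → e = d := by
  classical
  by_contra! hcon
  have hτρ : SameCycle.setoid τ ≤ SameCycle.setoid ρ := setoid_le_of_forall_apply hloop
  -- With loops only, each component is a single vertex, so the bound reads: ends plus vertices is
  -- at most edge orbits plus faces. The negated goal gives every live end a second live end in its
  -- face, and counting contradicts this.
  have hC : SameCycle.setoid ρ ⊔ SameCycle.setoid τ = SameCycle.setoid ρ := sup_eq_left.2 hτρ
  unfold HasEulerBound at h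
  rw [hC] at h
  change Nat.card D + 2 * orbitCount ρ ≤ _ at h
  let live : Finset D := Finset.univ.filter fun x => τ x ≠ x
  let dead : Finset D := Finset.univ.filter fun x => ¬ τ x ≠ x
  have hcard : live.card + dead.card = Nat.card D := by
    rw [Nat.card_eq_fintype_card, ← Finset.card_univ]
    exact Finset.card_filter_add_card_filter_not _
  -- If every live end shares its orbit with another live end, at most half as many orbits as live
  -- ends contain a live end.
  have hfib : ∀ p : Equiv.Perm D, (∀ d, τ d ≠ d → ∃ e, τ e ≠ e ∧ SameCycle p d e ∧ e ≠ d) →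
      2 * (live.image (Quotient.mk (SameCycle.setoid p))).card ≤ live.card := by
    intro p hp
    refine Finset.mul_card_image_le_card live 2 ?_
    intro c hc
    obtain ⟨d, hd, rfl⟩ := Finset.mem_image.1 hc
    obtain ⟨e, he, hde, hne⟩ := hp d (Finset.mem_filter.1 hd).2
    refine Finset.one_lt_card.2 ⟨e, ?_, d, ?_, hne⟩
    · exact Finset.mem_filter.2 ⟨Finset.mem_filter.2 ⟨Finset.mem_univ _, he⟩,
        Quotient.sound (SameCycle.symm hde)⟩
    · exact Finset.mem_filter.2 ⟨hd, rfl⟩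
  have hcount : ∀ p : Equiv.Perm D, orbitCount p
      = (live.image (Quotient.mk (SameCycle.setoid p))).card
        + ((live.image (Quotient.mk (SameCycle.setoid p)))ᶜ).card := by
    intro p
    rw [Finset.card_add_card_compl, orbitCount, Nat.card_eq_fintype_card]
  have h1 := hfib τ fun d hd => ⟨τ d, by rw [hτ d]; exact hd.symm,
    sameCycle_apply_right.2 (SameCycle.refl _ _), hd⟩
  have h2 := hfib (ρ * τ) fun d hd => hcon d hd
  have h3 : ((live.image (Quotient.mk (SameCycle.setoid τ)))ᶜ).card ≤ dead.card := by
    refine (Finset.card_le_card ?_).trans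
      (Finset.card_image_le (s := dead) (f := Quotient.mk (SameCycle.setoid τ)))
    intro c
    induction c using Quotient.inductionOn with
    | h x =>
      intro hc
      refine Finset.mem_image_of_mem _ (Finset.mem_filter.2 ⟨Finset.mem_univ _, fun hx => ?_⟩)
      exact Finset.mem_compl.1 hc
        (Finset.mem_image_of_mem _ (Finset.mem_filter.2 ⟨Finset.mem_univ _, hx⟩))
  obtain ⟨x₀, hx₀⟩ := hne
  have hdead : ∀ x, Quotient.mk (SameCycle.setoid (ρ * τ)) x
      ∈ (live.image (Quotient.mk (SameCycle.setoid (ρ * τ))))ᶜ →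
      ∀ z, SameCycle (ρ * τ) x z → τ z = z := by
    intro x hx z hz
    by_contra hne
    exact Finset.mem_compl.1 hx (Finset.mem_image.2 ⟨z,
      Finset.mem_filter.2 ⟨Finset.mem_univ _, hne⟩, Quotient.sound (SameCycle.symm hz)⟩)
  -- Faces without live ends inject into the vertices and miss the vertex of the live end `x₀`; this
  -- saves the decisive unit.
  have h4 : ((live.image (Quotient.mk (SameCycle.setoid (ρ * τ))))ᶜ).card + 1 ≤ orbitCount ρ := by
    have : ((live.image (Quotient.mk (SameCycle.setoid (ρ * τ))))ᶜ).card
        ≤ (Finset.univ.erase (Quotient.mk (SameCycle.setoid ρ) x₀)).card := by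
      refine Finset.card_le_card_of_injOn
        (fun c => Quotient.mk (SameCycle.setoid ρ) c.out) ?_ ?_
      · intro c hc
        rw [Finset.mem_coe] at hc
        refine Finset.mem_coe.2 (Finset.mem_erase.2 ⟨fun hx => ?_, Finset.mem_univ _⟩)
        rw [← Quotient.out_eq c] at hc
        exact hx₀ (hdead _ hc _ (sameCycle_of_fixed_on_orbit (hdead _ hc) (Quotient.exact hx)))
      · intro c hc c' hc' hcc
        rw [Finset.mem_coe] at hc
        rw [← Quotient.out_eq c] at hc
        have := sameCycle_of_fixed_on_orbit (hdead _ hc) (Quotient.exact hcc)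
        rw [← Quotient.out_eq c, ← Quotient.out_eq c']
        exact Quotient.sound this
    rw [Finset.card_erase_of_mem (Finset.mem_univ _), Finset.card_univ] at this
    have hpos : 0 < Fintype.card (Quotient (SameCycle.setoid ρ)) :=
      Fintype.card_pos_iff.2 ⟨Quotient.mk _ x₀⟩
    rw [orbitCount, Nat.card_eq_fintype_card]
    omega
  have h5 := hcount τ
  have h6 := hcount (ρ * τ)
  -- Edge orbits number at most `live / 2 + dead` and faces at most `live / 2 + (vertices - 1)`; the
  -- sum is one short of the bound.
  omega

end Orbits

/-! ### Orthogonality in the rows and columns of a quantum permutation matrix. -/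

section Projections

variable {A : Type*} [CStarAlgebra A]

/-- Projections that sum to the unit are pairwise orthogonal. -/
theorem mul_eq_zero_of_sum_eq_one {κ : Type*} [Fintype κ] {p : κ → A}
    (hidem : ∀ i, p i * p i = p i) (hstar : ∀ i, star (p i) = p i) (hsum : ∑ i, p i = 1)
    {i j : κ} (hij : i ≠ j) : p i * p j = 0 := by
  classical
  let _ := CStarAlgebra.spectralOrder A
  let _ := CStarAlgebra.spectralOrderedRing A
  -- Compressing `∑ k, p k = 1` by `p j` leaves a vanishing sum of the positive elements `p j * p k
  -- * p j` with `k ≠ j`. Each one is zero, and the C*-identity then kills `p k * p j`.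
  have hform : ∀ k, p j * p k * p j = star (p k * p j) * (p k * p j) := fun k => by
    rw [star_mul, hstar, hstar, mul_assoc (p j) (p k) (p k * p j), ← mul_assoc (p k) (p k),
      hidem, mul_assoc]
  have h0 : ∑ k ∈ Finset.univ.erase j, p j * p k * p j = 0 := by
    have h1 : ∑ k, p j * p k * p j = p j := by
      rw [← Finset.sum_mul, ← Finset.mul_sum, hsum, mul_one, hidem]
    rw [← Finset.add_sum_erase _ _ (Finset.mem_univ j), hidem, hidem] at h1
    exact left_eq_add.1 h1.symm
  have h2 := (Finset.sum_eq_zero_iff_of_nonneg fun k _ => by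
    rw [hform]; exact star_mul_self_nonneg _).1 h0 i (Finset.mem_erase.2 ⟨hij, Finset.mem_univ _⟩)
  rw [hform] at h2
  exact CStarRing.star_mul_self_eq_zero_iff _ |>.1 h2

variable {q : ℕ} {U : Matrix (Fin q) (Fin q) A}

theorem IsQuantumPermutation.row_mul (hU : IsQuantumPermutation U) (i j k : Fin q) :
    U i j * U i k = if j = k then U i j else 0 := by
  split_ifs with h
  · rw [← h, hU.idempotent]
  · exact mul_eq_zero_of_sum_eq_one (hU.idempotent i) (hU.selfAdjoint i) (hU.row_sum i) h

theorem IsQuantumPermutation.col_mul (hU : IsQuantumPermutation U) (i j k : Fin q) :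
    U i k * U j k = if i = j then U i k else 0 := by
  split_ifs with h
  · rw [← h, hU.idempotent]
  · exact mul_eq_zero_of_sum_eq_one (p := fun i => U i k) (fun i => hU.idempotent i k)
      (fun i => hU.selfAdjoint i k) (hU.col_sum k) h

end Projections

/-! ### The action of `U` along a word of coordinates. -/

section Act

open Function

variable {A : Type*} [CStarAlgebra A] {q : ℕ} {D : Type*} [DecidableEq D]

/-- `F` does not depend on the coordinate `a`. -/
def Indep {X B : Type*} (a : D) (F : (D → X) → B) : Prop :=
  ∀ x z, F (update x a z) = F x

/-- Apply `U` to the coordinate `a` of `F`, multiplying from the left. -/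
def actAt (U : Matrix (Fin q) (Fin q) A) (a : D) (F : (D → Fin q) → A) : (D → Fin q) → A :=
  fun x => ∑ z, U (x a) z * F (update x a z)

/-- Apply `U` to the coordinates in the list `w`, in this order of the factors. -/
def act (U : Matrix (Fin q) (Fin q) A) (w : List D) (F : (D → Fin q) → A) : (D → Fin q) → A :=
  w.foldr (actAt U) F

/-- Set the coordinates `d` and `e` to a common value and sum over it. -/
def contract {B : Type*} [AddCommMonoid B] (d e : D) (F : (D → Fin q) → B) : (D → Fin q) → B :=
  fun x => ∑ z, F (update (update x d z) e z)

variable {U : Matrix (Fin q) (Fin q) A}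

theorem Indep.of_contract_left {B : Type*} [AddCommMonoid B] (d e : D) (F : (D → Fin q) → B) :
    Indep d (contract d e F) := by
  intro x z
  simp only [contract, update_idem]

theorem contract_comm {B : Type*} [AddCommMonoid B] {d e : D} (h : d ≠ e) (F : (D → Fin q) → B) :
    contract d e F = contract e d F := by
  funext x
  simp only [contract, update_comm h]

theorem Indep.of_contract_right {B : Type*} [AddCommMonoid B] (d e : D) (F : (D → Fin q) → B) :
    Indep e (contract d e F) := by
  by_cases h : d = e
  · subst h; exact Indep.of_contract_left _ _ _
  · rw [contract_comm h]; exact Indep.of_contract_left _ _ _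

theorem Indep.contract {B : Type*} [AddCommMonoid B] {a : D} {F : (D → Fin q) → B}
    (h : Indep a F) (d e : D) : Indep a (contract d e F) := by
  by_cases hd : a = d
  · subst hd; exact Indep.of_contract_left _ _ _
  by_cases he : a = e
  · subst he; exact Indep.of_contract_right _ _ _
  intro x z
  simp only [QuantumHolant.contract]
  refine Finset.sum_congr rfl fun y _ => ?_
  rw [update_comm hd, update_comm he, h]

theorem Indep.mul {X B : Type*} [Mul B] {a : D} {F G : (D → X) → B} (hF : Indep a F)
    (hG : Indep a G) : Indep a (fun x => F x * G x) := fun x z => by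
  simp only [hF x z, hG x z]

theorem Indep.comp {X B C : Type*} {a : D} {F : (D → X) → B} (hF : Indep a F) (g : B → C) :
    Indep a (fun x => g (F x)) := fun x z => by
  simp only [hF x z]

theorem contract_mul {B : Type*} [CommSemiring B] {d e : D} (F H : (D → Fin q) → B)
    (hd : Indep d H) (he : Indep e H) :
    contract d e (fun x => F x * H x) = fun x => contract d e F x * H x := by
  funext x
  simp only [contract, Finset.sum_mul, hd _ _, he _ _]

theorem act_append (w v : List D) (F : (D → Fin q) → A) :
    act U (w ++ v) F = act U w (act U v F) := by
  simp [act, List.foldr_append]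

theorem act_cons (a : D) (w : List D) (F : (D → Fin q) → A) :
    act U (a :: w) F = actAt U a (act U w F) := rfl

theorem Indep.actAt {a b : D} {F : (D → Fin q) → A} (h : Indep a F) (hab : a ≠ b) :
    Indep a (actAt U b F) := by
  intro x z
  simp only [QuantumHolant.actAt, update_of_ne hab.symm]
  refine Finset.sum_congr rfl fun y _ => ?_
  rw [update_comm hab, h]

theorem Indep.act {a : D} {w : List D} {F : (D → Fin q) → A} (h : Indep a F) (hw : a ∉ w) :
    Indep a (act U w F) := by
  induction w with
  | nil => exact h
  | cons b w ih =>
    rw [List.mem_cons, not_or] at hw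
    exact (ih hw.2).actAt hw.1

theorem actAt_of_indep (hU : IsQuantumPermutation U) {a : D} {F : (D → Fin q) → A}
    (h : Indep a F) : actAt U a F = F := by
  funext x
  simp only [actAt, h _ _, ← Finset.sum_mul, hU.row_sum, one_mul]

theorem act_of_indep (hU : IsQuantumPermutation U) {w : List D} {F : (D → Fin q) → A}
    (h : ∀ a ∈ w, Indep a F) : act U w F = F := by
  induction w with
  | nil => rfl
  | cons b w ih =>
    rw [act_cons, ih fun a ha => h a (List.mem_cons_of_mem _ ha),
      actAt_of_indep hU (h b List.mem_cons_self)]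

theorem act_remove (hU : IsQuantumPermutation U) {u t v : List D} {F : (D → Fin q) → A}
    (h : ∀ a ∈ t, Indep a F) (ht : ∀ a ∈ t, a ∉ v) :
    act U (u ++ t ++ v) F = act U (u ++ v) F := by
  rw [act_append, act_append, act_append,
    act_of_indep hU fun a ha => (h a ha).act (ht a ha)]

theorem actAt_smul {a : D} {c : (D → Fin q) → ℂ} (hc : Indep a c) (F : (D → Fin q) → A) :
    actAt U a (fun x => c x • F x) = fun x => c x • actAt U a F x := by
  funext x
  simp only [actAt, hc _ _, Finset.smul_sum, mul_smul_comm]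

theorem act_smul {w : List D} {c : (D → Fin q) → ℂ} (hc : ∀ a ∈ w, Indep a c)
    (F : (D → Fin q) → A) :
    act U w (fun x => c x • F x) = fun x => c x • act U w F x := by
  induction w with
  | nil => rfl
  | cons b w ih =>
    rw [act_cons, ih fun a ha => hc a (List.mem_cons_of_mem _ ha),
      actAt_smul (hc b List.mem_cons_self)]
    rfl

theorem contract_actAt {a d e : D} (hd : a ≠ d) (he : a ≠ e) (F : (D → Fin q) → A) :
    contract d e (actAt U a F) = actAt U a (contract d e F) := by
  funext x
  simp only [contract, actAt, Finset.mul_sum, update_of_ne hd, update_of_ne he]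
  rw [Finset.sum_comm]
  refine Finset.sum_congr rfl fun y _ => Finset.sum_congr rfl fun z _ => ?_
  rw [update_comm he.symm, update_comm hd.symm]

theorem contract_act {w : List D} {d e : D} (hd : d ∉ w) (he : e ∉ w) (F : (D → Fin q) → A) :
    contract d e (act U w F) = act U w (contract d e F) := by
  induction w with
  | nil => rfl
  | cons b w ih =>
    rw [List.mem_cons, not_or] at hd he
    rw [act_cons, contract_actAt (Ne.symm hd.1) (Ne.symm he.1), ih hd.2 he.2]
    rfl

/-- Because the two factors are adjacent, row orthogonality gives `U s y * U s z = 0` unless `y =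
z`; the sum over `s` of what remains is a column sum, equal to 1. -/
theorem contract_actAt_actAt (hU : IsQuantumPermutation U) {d e : D} (h : d ≠ e)
    (F : (D → Fin q) → A) : contract d e (actAt U d (actAt U e F)) = contract d e F := by
  funext x
  simp only [contract, actAt, update_self, update_of_ne h, update_of_ne h.symm]
  have h1 : ∀ s y z : Fin q,
      update (update (update (update x d s) e s) d y) e z = update (update x d y) e z := by
    intro s y z
    rw [update_comm h.symm, update_idem, update_idem]
  have h2 : ∀ s : Fin q, ∑ y, U s y * ∑ z, U s z * F (update (update x d y) e z)
      = ∑ y, U s y * F (update (update x d y) e y) := by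
    intro s
    refine Finset.sum_congr rfl fun y _ => ?_
    simp only [Finset.mul_sum, ← mul_assoc, hU.row_mul, ite_mul, zero_mul, Finset.sum_ite_eq,
      Finset.mem_univ, if_true]
  simp only [h1, h2]
  rw [Finset.sum_comm]
  simp only [← Finset.sum_mul, hU.col_sum, one_mul]

/-- The complex-valued functions `F` and `G` are related by the action of `U` on the coordinates
in `w`. -/
def Transforms (U : Matrix (Fin q) (Fin q) A) (w : List D) (F G : (D → Fin q) → ℂ) : Prop :=
  act U w (fun x => algebraMap ℂ A (F x)) = fun x => algebraMap ℂ A (G x)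

theorem contract_algebraMap (d e : D) (F : (D → Fin q) → ℂ) :
    contract d e (fun x => algebraMap ℂ A (F x)) = fun x => algebraMap ℂ A (contract d e F x) := by
  funext x
  simp only [contract, map_sum]

theorem Transforms.contract (hU : IsQuantumPermutation U) {d e : D} {w : List D}
    {F G : (D → Fin q) → ℂ} (h : Transforms U (d :: e :: w) F G) (hde : d ≠ e) (hd : d ∉ w)
    (he : e ∉ w) : Transforms U w (contract d e F) (contract d e G) := by
  unfold Transforms at h ⊢
  rw [← contract_algebraMap, ← contract_algebraMap, ← h, act_cons, act_cons,
    contract_actAt_actAt hU hde, contract_act hd he]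

/-- The inner word turns `F * F'` into `F * G'`. Since `G'` is scalar, it is central and passes
through the factors of the outer word. -/
theorem Transforms.mul {w v : List D} {F G F' G' : (D → Fin q) → ℂ}
    (h : Transforms U w F G) (h' : Transforms U v F' G') (hF : ∀ a ∈ v, Indep a F)
    (hG' : ∀ a ∈ w, Indep a G') :
    Transforms U (w ++ v) (fun x => F x * F' x) (fun x => G x * G' x) := by
  unfold Transforms at h h' ⊢
  have h1 : (fun x => algebraMap ℂ A (F x * F' x)) = fun x => F x • algebraMap ℂ A (F' x) := by
    funext x; rw [map_mul, Algebra.smul_def]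
  have h2 : (fun x => F x • algebraMap ℂ A (G' x)) = fun x => G' x • algebraMap ℂ A (F x) := by
    funext x; rw [Algebra.smul_def, Algebra.smul_def, ← map_mul, ← map_mul, mul_comm]
  rw [act_append, h1, act_smul hF, h', h2, act_smul hG', h]
  funext x
  rw [Algebra.smul_def, ← map_mul, mul_comm]

theorem Transforms.remove (hU : IsQuantumPermutation U) {u t v : List D} {F G : (D → Fin q) → ℂ}
    (hF : ∀ a ∈ t, Indep a F) (ht : ∀ a ∈ t, a ∉ v) :
    Transforms U (u ++ t ++ v) F G ↔ Transforms U (u ++ v) F G := by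
  unfold Transforms
  rw [act_remove hU (fun a ha => (hF a ha).comp _) ht]

theorem act_right_mul {w : List D} {a : D} (ha : a ∉ w) (F : (D → Fin q) → A) :
    act U w (fun x => ∑ z, F (update x a z) * U (x a) z)
      = fun x => ∑ z, act U w F (update x a z) * U (x a) z := by
  induction w with
  | nil => rfl
  | cons b w ih =>
    rw [List.mem_cons, not_or] at ha
    rw [act_cons, ih ha.2, act_cons]
    funext x
    simp only [actAt, Finset.mul_sum, Finset.sum_mul, update_of_ne ha.1,
      update_of_ne (Ne.symm ha.1)]
    rw [Finset.sum_comm]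
    refine Finset.sum_congr rfl fun y _ => Finset.sum_congr rfl fun z _ => ?_
    rw [update_comm ha.1, mul_assoc]

/-- With `T` the result of the remaining word, the hypothesis reads `∑ t, U s t * T t = G s`. Row
orthogonality and column sums invert it to `T t = ∑ s, U s t * G s`. As `G` is scalar, column
orthogonality gives `T t * U s t = G s * U s t`, and summing over `t` puts the factor at the right
end. -/
theorem Transforms.rotate (hU : IsQuantumPermutation U) {a : D} {w : List D}
    {F G : (D → Fin q) → ℂ} (h : Transforms U (a :: w) F G) (ha : a ∉ w) :
    Transforms U (w ++ [a]) F G := by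
  unfold Transforms at h ⊢
  set T := act U w (fun x => algebraMap ℂ A (F x)) with hT
  have h1 : ∀ x s t, U s t * T (update x a t) = U s t * algebraMap ℂ A (G (update x a s)) := by
    intro x s t
    have := congrFun h (update x a s)
    rw [← this, act_cons]
    simp only [actAt, update_self, update_idem, Finset.mul_sum, ← mul_assoc, hU.row_mul, ite_mul,
      zero_mul, Finset.sum_ite_eq, Finset.mem_univ, if_true]
    rfl
  have h2 : ∀ x t, T (update x a t) = ∑ s, U s t * algebraMap ℂ A (G (update x a s)) := by
    intro x t
    simp only [← h1, ← Finset.sum_mul, hU.col_sum, one_mul]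
  have h3 : ∀ x s t, T (update x a t) * U s t = algebraMap ℂ A (G (update x a s)) * U s t := by
    intro x s t
    rw [h2, Finset.sum_mul]
    have : ∀ r, U r t * algebraMap ℂ A (G (update x a r)) * U s t
        = if r = s then algebraMap ℂ A (G (update x a r)) * U r t else 0 := by
      intro r
      rw [← Algebra.commutes, mul_assoc, hU.col_mul]
      split_ifs <;> simp
    simp only [this, Finset.sum_ite_eq', Finset.mem_univ, if_true]
  have h4 : act U [a] (fun x => algebraMap ℂ A (F x))
      = fun x => ∑ z, algebraMap ℂ A (F (update x a z)) * U (x a) z := by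
    funext x
    simp only [act, List.foldr, actAt, Algebra.commutes]
  rw [act_append, h4, act_right_mul ha (fun x => algebraMap ℂ A (F x)), ← hT]
  funext x
  simp only [h3, ← Finset.mul_sum, hU.row_sum, mul_one, update_eq_self]

theorem Transforms.rotate_append (hU : IsQuantumPermutation U) {u v : List D}
    {F G : (D → Fin q) → ℂ} (h : Transforms U (u ++ v) F G) (hn : (u ++ v).Nodup) :
    Transforms U (v ++ u) F G := by
  induction u generalizing v with
  | nil => simpa using h
  | cons a u ih =>
    rw [List.cons_append, List.nodup_cons] at hn
    have h1 : Transforms U (u ++ v ++ [a]) F G := Transforms.rotate hU h hn.1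
    rw [List.append_assoc] at h1
    have h2 := ih h1 (by
      rw [← List.append_assoc]
      exact (List.nodup_append_comm.2 (by simpa using hn)))
    simpa using h2

end Act

/-! ### Words that list an orbit of the rotation. -/

section CycleWord

variable {D : Type*}

/-- The list `w`, read cyclically, is an orbit of `ρ` (or `w` is empty). -/
def IsCycleWord (ρ : Equiv.Perm D) : List D → Prop
  | [] => True
  | a :: u => List.IsChain (fun x y => ρ x = y) (a :: (u ++ [a]))

variable {ρ ρ' : Equiv.Perm D}

theorem isChain_congr {l : List D} {x x' y : D}
    (h : List.IsChain (fun x y => ρ x = y) (x :: (l ++ [y]))) (hx : ρ' x' = ρ x)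
    (hl : ∀ a ∈ l, ρ' a = ρ a) : List.IsChain (fun x y => ρ' x = y) (x' :: (l ++ [y])) := by
  induction l generalizing x x' with
  | nil => simpa [hx] using h
  | cons b l ih =>
    rw [List.cons_append, List.isChain_cons_cons] at h ⊢
    exact ⟨hx.trans h.1, ih h.2 (hl b List.mem_cons_self)
      fun a ha => hl a (List.mem_cons_of_mem _ ha)⟩

theorem IsCycleWord.congr {w : List D} (h : IsCycleWord ρ w) (hw : ∀ a ∈ w, ρ' a = ρ a) :
    IsCycleWord ρ' w := by
  cases w with
  | nil => trivial
  | cons a u =>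
    exact isChain_congr h (hw a List.mem_cons_self) fun b hb => hw b (List.mem_cons_of_mem _ hb)

theorem IsCycleWord.rotate {u v : List D} (h : IsCycleWord ρ (u ++ v)) :
    IsCycleWord ρ (v ++ u) := by
  induction u generalizing v with
  | nil => simpa using h
  | cons a u ih =>
    have h1 : IsCycleWord ρ (u ++ v ++ [a]) := by
      change List.IsChain _ (a :: ((u ++ v) ++ [a])) at h
      generalize u ++ v = l at h
      cases l with
      | nil => exact h
      | cons b l =>
        rw [List.cons_append, List.isChain_cons_cons] at h
        change List.IsChain _ (b :: ((l ++ [a]) ++ [b]))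
        rw [List.append_assoc, List.singleton_append, List.isChain_cons_append_cons_cons]
        exact ⟨h.2, h.1, List.isChain_singleton b⟩
    rw [List.append_assoc] at h1
    simpa using ih h1

theorem IsCycleWord.apply_mem {w : List D} {a : D} (h : IsCycleWord ρ w) (ha : a ∈ w) :
    ρ a ∈ w := by
  obtain ⟨u, v, rfl⟩ := List.append_of_mem ha
  have h1 := h.rotate
  change List.IsChain _ (a :: ((v ++ u) ++ [a])) at h1
  generalize hl : v ++ u = l at h1
  cases l with
  | nil =>
    have : ρ a = a := by simpa using h1
    rw [this]; exact ha
  | cons b l =>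
    rw [List.cons_append, List.isChain_cons_cons] at h1
    have hb : b ∈ v ++ u := by rw [hl]; exact List.mem_cons_self
    rw [h1.1]
    rw [List.mem_append] at hb
    simp only [List.mem_append, List.mem_cons]
    tauto

theorem IsCycleWord.mem_of_sameCycle [Finite D] {w : List D} {a b : D} (h : IsCycleWord ρ w)
    (ha : a ∈ w) (hab : SameCycle ρ a b) : b ∈ w := by
  obtain ⟨k, rfl⟩ := SameCycle.exists_nat_pow_eq hab
  clear hab
  induction k with
  | zero => exact ha
  | succ k ih =>
    rw [pow_succ', Equiv.Perm.mul_apply]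
    exact h.apply_mem ih

theorem sameCycle_of_isChain {l : List D} {x b : D}
    (h : List.IsChain (fun x y => ρ x = y) (x :: l)) (hb : b ∈ x :: l) : SameCycle ρ x b := by
  induction l generalizing x with
  | nil => rw [List.mem_singleton.1 hb]
  | cons y l ih =>
    rw [List.isChain_cons_cons] at h
    rcases List.mem_cons.1 hb with rfl | hb
    · exact SameCycle.refl _ _
    · have := ih h.2 hb
      rw [← h.1] at this
      exact sameCycle_apply_left.1 this

theorem IsCycleWord.sameCycle {w : List D} {a b : D} (h : IsCycleWord ρ w) (ha : a ∈ w)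
    (hb : b ∈ w) : SameCycle ρ a b := by
  obtain ⟨u, v, rfl⟩ := List.append_of_mem ha
  have h1 := h.rotate
  change List.IsChain _ (a :: ((v ++ u) ++ [a])) at h1
  refine sameCycle_of_isChain h1 ?_
  simp only [List.mem_append, List.mem_cons] at hb ⊢
  tauto

/-- The new rotation sends `d` to `ρ e` and `e` to `ρ d`, so it runs through `v` after `d` and
through `u` after `e`. -/
theorem IsCycleWord.merge [DecidableEq D] {d e : D} {u v : List D} (h : IsCycleWord ρ (d :: u))
    (h' : IsCycleWord ρ (e :: v)) (hd : d ∉ u ++ v) (he : e ∉ u ++ v) :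
    IsCycleWord (ρ * Equiv.swap d e) (d :: (v ++ e :: u)) := by
  have hne : ∀ a ∈ u ++ v, (ρ * Equiv.swap d e) a = ρ a := by
    intro a ha
    rw [Equiv.Perm.mul_apply, Equiv.swap_apply_of_ne_of_ne] <;> rintro rfl <;> contradiction
  change List.IsChain _ (d :: ((v ++ e :: u) ++ [d]))
  rw [List.append_assoc, List.cons_append, List.isChain_cons_split]
  exact ⟨isChain_congr h' (by simp) fun a ha => hne a (List.mem_append_right _ ha),
    isChain_congr h (by simp) fun a ha => hne a (List.mem_append_left _ ha)⟩

/-- As long as only dead ends are met, `ρ * τ` advances like `ρ`. The walk therefore stays in the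
face of `d`, whose only possible live end is `d` itself. -/
theorem fixed_of_innermost {τ : Equiv.Perm D} {d x : D} {t : List D}
    (hd : ∀ e, τ e ≠ e → SameCycle (ρ * τ) d e → e = d)
    (h : List.IsChain (fun x y => ρ x = y) (x :: (t ++ [d]))) (hx : SameCycle (ρ * τ) d (ρ x))
    (ht : d ∉ t) : ∀ a ∈ t, τ a = a := by
  induction t generalizing x with
  | nil => simp
  | cons b t ih =>
    rw [List.cons_append, List.isChain_cons_cons] at h
    rw [List.mem_cons, not_or] at ht
    have hb : τ b = b := by
      by_contra hb
      exact ht.1 (hd b hb (h.1 ▸ hx)).symm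
    intro a ha
    rcases List.mem_cons.1 ha with rfl | ha
    · exact hb
    · refine ih h.2 ?_ ht.2 a ha
      have : SameCycle (ρ * τ) d ((ρ * τ) b) := sameCycle_apply_right.2 (h.1 ▸ hx)
      rwa [Equiv.Perm.mul_apply, hb] at this

end CycleWord

/-! ### Holant sums over assignments of edge ends. -/

section Total

open Function

variable {D : Type*} [DecidableEq D] [Fintype D] {q : ℕ}

/-- The sum of `P` over the assignments that agree on the two ends of every edge. -/
def total (τ : Equiv.Perm D) (P : (D → Fin q) → ℂ) : ℂ :=
  ∑ σ with ∀ a, σ (τ a) = σ a, P σ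

/-- After detaching, the values at `d` and `τ d` are free while the contracted tensor ignores them;
this gives `q ^ 2`. The bijection exchanges the summation variable of the contraction with the
common value on the edge. -/
theorem total_contract {τ : Equiv.Perm D} (hτ : Involutive τ) {d : D} (hd : τ d ≠ d)
    (P : (D → Fin q) → ℂ) :
    total (detach τ d) (contract d (τ d) P) = (q : ℂ) ^ 2 * total τ P := by
  have h1 : (q : ℂ) ^ 2 * total τ P
      = ∑ y ∈ (Finset.univ.filter fun σ : D → Fin q => ∀ a, σ (τ a) = σ a)
          ×ˢ (Finset.univ : Finset (Fin q × Fin q)), P y.1 := by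
    rw [Finset.sum_product, total, Finset.mul_sum]
    refine Finset.sum_congr rfl fun σ _ => ?_
    simp [pow_two]
  have h2 : total (detach τ d) (contract d (τ d) P)
      = ∑ y ∈ (Finset.univ.filter fun σ : D → Fin q => ∀ a, σ (detach τ d a) = σ a)
          ×ˢ (Finset.univ : Finset (Fin q)), P (update (update y.1 d y.2) (τ d) y.2) := by
    rw [Finset.sum_product]
    rfl
  rw [h1, h2]
  refine Finset.sum_nbij'
    (fun y => (update (update y.1 d y.2) (τ d) y.2, y.1 d, y.1 (τ d)))
    (fun y => (update (update y.1 d y.2.1) (τ d) y.2.2, y.1 d)) ?_ ?_ ?_ ?_ ?_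
  · rintro ⟨σ, z⟩ hy
    simp only [Finset.mem_product, Finset.mem_filter, Finset.mem_univ, true_and, and_true] at hy ⊢
    intro a
    by_cases h1 : a = d
    · subst h1; simp [update_of_ne hd.symm]
    by_cases h2 : a = τ d
    · subst h2; simp [hτ d, update_of_ne hd.symm]
    have h3 : τ a ≠ d := fun h => h2 (by rw [← h, hτ a])
    have h4 : τ a ≠ τ d := fun h => h1 (τ.injective h)
    rw [update_of_ne h4, update_of_ne h3, update_of_ne h2, update_of_ne h1, ← hy a,
      detach_apply_of_ne hτ h1 h2]
  · rintro ⟨σ, s, t⟩ hy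
    simp only [Finset.mem_product, Finset.mem_filter, Finset.mem_univ, true_and, and_true] at hy ⊢
    intro a
    by_cases h1 : a = d
    · subst h1; rw [detach_apply_self]
    by_cases h2 : a = τ d
    · subst h2; rw [detach_apply_apply hτ]
    have h3 : τ a ≠ d := fun h => h2 (by rw [← h, hτ a])
    have h4 : τ a ≠ τ d := fun h => h1 (τ.injective h)
    rw [detach_apply_of_ne hτ h1 h2, update_of_ne h4, update_of_ne h3, update_of_ne h2,
      update_of_ne h1, hy a]
  · rintro ⟨σ, z⟩ _
    simp only [update_of_ne hd.symm, update_self, Prod.mk.injEq, and_true]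
    rw [update_comm hd, update_idem, update_idem, update_eq_self, update_eq_self]
  · rintro ⟨σ, s, t⟩ hy
    simp only [Finset.mem_product, Finset.mem_filter, Finset.mem_univ, true_and, and_true] at hy
    simp only [update_of_ne hd.symm, update_self, Prod.mk.injEq, and_true]
    rw [update_comm hd, update_idem, update_idem, update_eq_self, ← hy d, update_eq_self]
  · rintro ⟨σ, z⟩ _
    rfl

theorem total_eq_of_contract {τ : Equiv.Perm D} (hτ : Involutive τ) {d : D} (hd : τ d ≠ d)
    {P Q : (D → Fin q) → ℂ}
    (h : total (detach τ d) (contract d (τ d) P) = total (detach τ d) (contract d (τ d) Q)) :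
    total τ P = total τ Q := by
  rw [total_contract hτ hd, total_contract hτ hd] at h
  -- For `q = 0` the factor cannot be cancelled, but no assignment exists since `D` contains `d`.
  rcases Nat.eq_zero_or_pos q with rfl | hq
  · have : IsEmpty (D → Fin 0) := ⟨fun σ => (σ d).elim0⟩
    simp [total]
  · exact mul_left_cancel₀ (pow_ne_zero 2 (Nat.cast_ne_zero.2 hq.ne')) h

end Total

/-! ### Grids as lists of blocks. -/

section Blocks

variable {A : Type*} [CStarAlgebra A] {q : ℕ} {D : Type*} [DecidableEq D]

/-- A vertex of a grid: the cyclic word of its edge ends, with a pair of tensors. -/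
structure Block (D : Type*) (q : ℕ) where
  word : List D
  left : (D → Fin q) → ℂ
  right : (D → Fin q) → ℂ

/-- The word is an orbit of `ρ`, the matrix `U` transforms the left tensor into the right one, and
both depend only on the edge ends in the word that are not fixed by `τ`. -/
structure Block.Valid (U : Matrix (Fin q) (Fin q) A) (ρ τ : Equiv.Perm D) (B : Block D q) :
    Prop where
  cycle : IsCycleWord ρ B.word
  transforms : Transforms U B.word B.left B.right
  indep_left : ∀ a, a ∉ B.word ∨ τ a = a → Indep a B.left
  indep_right : ∀ a, a ∉ B.word ∨ τ a = a → Indep a B.right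

/-- A grid presented as a list of blocks, whose words partition the edge ends. -/
structure IsState (U : Matrix (Fin q) (Fin q) A) (ρ τ : Equiv.Perm D) (S : List (Block D q)) :
    Prop where
  valid : ∀ B ∈ S, B.Valid U ρ τ
  nodup : (S.flatMap Block.word).Nodup
  cover : ∀ a, a ∈ S.flatMap Block.word

variable {U : Matrix (Fin q) (Fin q) A} {ρ ρ' τ : Equiv.Perm D} {S S' : List (Block D q)}

theorem IsState.perm (h : IsState U ρ τ S) (hS : S.Perm S') : IsState U ρ τ S' where
  valid B hB := h.valid B (hS.mem_iff.2 hB)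
  nodup := ((hS.flatMap_right _).nodup_iff).1 h.nodup
  cover a := ((hS.flatMap_right _).mem_iff).1 (h.cover a)

theorem IsState.rotate (hU : IsQuantumPermutation U) {B : Block D q} {u v : List D}
    (h : IsState U ρ τ (B :: S)) (hB : B.word = u ++ v) :
    IsState U ρ τ (⟨v ++ u, B.left, B.right⟩ :: S) := by
  have hv := h.valid B List.mem_cons_self
  have hn := h.nodup
  have hp : List.Perm (B.word ++ S.flatMap Block.word) (v ++ u ++ S.flatMap Block.word) := by
    rw [hB]; exact List.perm_append_comm.append_right _
  rw [List.flatMap_cons] at hn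
  have hm : ∀ a, a ∈ v ++ u ↔ a ∈ B.word := fun a => by
    rw [hB]; exact List.perm_append_comm.mem_iff
  refine ⟨?_, ?_, fun a => ?_⟩
  · intro C hC
    rcases List.mem_cons.1 hC with rfl | hC
    · refine ⟨(hB ▸ hv.cycle).rotate, Transforms.rotate_append hU (hB ▸ hv.transforms)
        (hB ▸ hn.of_append_left), fun a ha => hv.indep_left a ?_, fun a ha => hv.indep_right a ?_⟩
      · rwa [hm] at ha
      · rwa [hm] at ha
    · exact h.valid C (List.mem_cons_of_mem _ hC)
  · rw [List.flatMap_cons]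
    exact hp.nodup_iff.1 hn
  · rw [List.flatMap_cons]
    exact hp.mem_iff.1 (h.cover a)

theorem IsState.exists_cons (h : IsState U ρ τ S) (a : D) :
    ∃ B S', S.Perm (B :: S') ∧ a ∈ B.word := by
  classical
  obtain ⟨B, hB, ha⟩ := List.mem_flatMap.1 (h.cover a)
  exact ⟨B, S.erase B, List.perm_cons_erase hB, ha⟩

theorem Block.Valid.detach {B : Block D q} (h : B.Valid U ρ τ) (hτ : Function.Involutive τ) {d : D}
    (hd : d ∉ B.word) (hd' : τ d ∉ B.word) (hρ : ∀ a ∈ B.word, ρ' a = ρ a) :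
    B.Valid U ρ' (detach τ d) := by
  have key : ∀ a, a ∉ B.word ∨ QuantumHolant.detach τ d a = a → a ∉ B.word ∨ τ a = a := by
    intro a ha
    by_cases h1 : a = d
    · subst h1; exact Or.inl hd
    by_cases h2 : a = τ d
    · subst h2; exact Or.inl hd'
    rwa [detach_apply_of_ne hτ h1 h2] at ha
  exact ⟨h.cycle.congr hρ, h.transforms, fun a ha => h.indep_left a (key a ha),
    fun a ha => h.indep_right a (key a ha)⟩

theorem indep_contract_detach (hτ : Function.Involutive τ) {d : D} {w w' : List D}
    {F : (D → Fin q) → ℂ} (hF : ∀ a, a ∉ w ∨ τ a = a → Indep a F) (hw : ∀ a ∈ w, a ∈ w') (a : D)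
    (ha : a ∉ w' ∨ detach τ d a = a) : Indep a (contract d (τ d) F) := by
  by_cases h1 : a = d
  · subst h1; exact Indep.of_contract_left _ _ _
  by_cases h2 : a = τ d
  · subst h2; exact Indep.of_contract_right _ _ _
  rw [detach_apply_of_ne hτ h1 h2] at ha
  exact (hF a (ha.imp_left (mt (hw a)))).contract _ _

theorem indep_prod {g : Block D q → (D → Fin q) → ℂ} {a : D} (h : ∀ B ∈ S, Indep a (g B)) :
    Indep a (fun σ => (S.map fun B => g B σ).prod) := by
  intro x z
  simp only
  congr 1
  exact List.map_congr_left fun B hB => h B hB x z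

end Blocks

/-! ### Elimination of edges. -/

section Reduction

variable {A : Type*} [CStarAlgebra A] {q : ℕ} {D : Type*} [DecidableEq D]
  {U : Matrix (Fin q) (Fin q) A} {ρ τ : Equiv.Perm D} {S : List (Block D q)}

/-- Contract an edge between two different blocks. -/
theorem IsState.contractEdge (hU : IsQuantumPermutation U) (hτ : Function.Involutive τ) {d : D}
    {B C : Block D q} {u v : List D} (h : IsState U ρ τ (B :: C :: S)) (hB : B.word = d :: u)
    (hC : C.word = τ d :: v) :
    IsState U (ρ * Equiv.swap d (τ d)) (detach τ d)
      (⟨d :: (v ++ τ d :: u), contract d (τ d) fun σ => B.left σ * C.left σ,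
        contract d (τ d) fun σ => B.right σ * C.right σ⟩ :: S) := by
  have hBv := h.valid B (by simp)
  have hCv := h.valid C (by simp)
  have hp : List.Perm ((B :: C :: S).flatMap Block.word)
      (d :: (v ++ τ d :: u) ++ S.flatMap Block.word) := by
    rw [List.flatMap_cons, List.flatMap_cons, ← List.append_assoc, hB, hC]
    refine List.Perm.append_right _ ?_
    rw [List.cons_append]
    exact (List.perm_append_comm (l₁ := u) (l₂ := τ d :: v)).cons d |>.trans
      ((List.perm_middle (l₁ := v) (l₂ := u) (a := τ d)).symm.cons d)
  have hn := hp.nodup_iff.1 h.nodup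
  have hn1 := List.nodup_append.1 hn
  have hdn := List.nodup_cons.1 hn1.1
  have hen : τ d ∉ v ++ u := (List.nodup_middle.1 hdn.2).notMem
  have hd : d ∉ v ++ u := fun hm => hdn.1 (by
    rw [List.mem_append] at hm; simp only [List.mem_append, List.mem_cons]; tauto)
  have hde : d ≠ τ d := fun hm => hdn.1 (by
    rw [List.mem_append]; exact Or.inr (hm ▸ List.mem_cons_self))
  have huv : ∀ a ∈ v, a ∉ τ d :: u := fun a ha hm =>
    (List.nodup_append.1 hdn.2).2.2 a ha a hm rfl
  simp only [List.mem_append, not_or] at hd hen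
  have hBC : ∀ a ∈ C.word, a ∉ B.word := by
    intro a ha hm
    rw [hC, List.mem_cons] at ha
    rw [hB, List.mem_cons] at hm
    rcases ha with rfl | ha <;> rcases hm with hm | hm
    · exact hde hm.symm
    · exact hen.2 hm
    · exact hd.1 (hm ▸ ha)
    · exact huv a ha (List.mem_cons_of_mem _ hm)
  have hwB : ∀ a ∈ B.word, a ∈ B.word ++ C.word := fun a ha => List.mem_append_left _ ha
  have hww : ∀ a ∈ B.word ++ C.word, a ∈ d :: (v ++ τ d :: u) := by
    intro a ha
    rw [hB, hC] at ha
    simp only [List.mem_append, List.mem_cons] at ha ⊢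
    tauto
  refine ⟨?_, ?_, fun a => ?_⟩
  · intro X hX
    rcases List.mem_cons.1 hX with rfl | hX
    · refine ⟨?_, ?_, ?_, ?_⟩
      · refine (hB ▸ hBv.cycle).merge (hC ▸ hCv.cycle) ?_ ?_ <;>
          simp only [List.mem_append, not_or] <;> tauto
      -- Rotating `d` to the end of the first word makes it adjacent to `τ d` at the start of the
      -- second; a further rotation brings the pair to the front for contraction.
      · have h1 : Transforms U (u ++ [d]) B.left B.right :=
          (hB ▸ hBv.transforms : Transforms U (d :: u) _ _).rotate hU hd.2
        have h2 := h1.mul (v := τ d :: v) (hC ▸ hCv.transforms)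
          (fun a ha => hBv.indep_left a (Or.inl (hBC a (hC ▸ ha))))
          (fun a ha => hCv.indep_right a (Or.inl fun hm => hBC a hm (by
            rw [hB]; simp only [List.mem_append, List.mem_singleton] at ha
            rw [List.mem_cons]; tauto)))
        rw [List.append_assoc] at h2
        have hn2 : (u ++ ([d] ++ τ d :: v)).Nodup := by
          refine (List.Perm.nodup_iff ?_).1 hn1.1
          rw [List.singleton_append]
          refine List.Perm.symm (List.perm_middle.trans (List.Perm.cons d ?_))
          refine List.perm_middle.trans ((List.Perm.cons _ List.perm_append_comm).trans ?_)
          exact List.perm_middle.symm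
        have h3 := h2.rotate_append hU hn2
        have h4 : Transforms U (v ++ u) _ _ := Transforms.contract hU h3 hde
          (by simp only [List.mem_append]; tauto) (by simp only [List.mem_append]; tauto)
        -- The contracted tensors ignore `d` and `τ d`, which are put back as dead ends where the
        -- merged cycle word requires them.
        have h5 := (Transforms.remove hU (t := [τ d]) (u := v) (v := u)
          (fun a ha => by rw [List.mem_singleton.1 ha]; exact Indep.of_contract_right _ _ _)
          (fun a ha => by rw [List.mem_singleton.1 ha]; exact hen.2)).2 h4
        rw [List.append_assoc, List.singleton_append] at h5
        exact (Transforms.remove hU (t := [d]) (u := []) (v := v ++ τ d :: u)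
          (F := contract d (τ d) fun σ => B.left σ * C.left σ)
          (fun a ha => by rw [List.mem_singleton.1 ha]; exact Indep.of_contract_left _ _ _)
          (fun a ha => by rw [List.mem_singleton.1 ha]; exact hdn.1)).2 h5
      · refine indep_contract_detach (F := fun σ => B.left σ * C.left σ) hτ
          (w := B.word ++ C.word) (fun a ha => ?_) hww
        rw [List.mem_append, not_or] at ha
        exact (hBv.indep_left a (by tauto)).mul (hCv.indep_left a (by tauto))
      · refine indep_contract_detach (F := fun σ => B.right σ * C.right σ) hτ
          (w := B.word ++ C.word) (fun a ha => ?_) hww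
        rw [List.mem_append, not_or] at ha
        exact (hBv.indep_right a (by tauto)).mul (hCv.indep_right a (by tauto))
    · have hX' : ∀ a ∈ X.word, a ∈ S.flatMap Block.word := fun a ha =>
        List.mem_flatMap.2 ⟨X, hX, ha⟩
      have h1 : d ∉ X.word := fun hm => hn1.2.2 d (by simp) d (hX' d hm) rfl
      have h2 : τ d ∉ X.word := fun hm => hn1.2.2 (τ d) (by simp) (τ d) (hX' _ hm) rfl
      refine (h.valid X (by simp [hX])).detach hτ h1 h2 fun a ha => ?_
      rw [Equiv.Perm.mul_apply, Equiv.swap_apply_of_ne_of_ne] <;> rintro rfl <;> contradiction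
  · rw [List.flatMap_cons]
    exact hn
  · rw [List.flatMap_cons]
    exact hp.mem_iff.1 (h.cover a)

/-- Remove a loop whose ends are adjacent, up to fixed points of `τ`. -/
theorem IsState.removeLoop (hU : IsQuantumPermutation U) (hτ : Function.Involutive τ) {d : D}
    (hd : τ d ≠ d) {B : Block D q} {t r : List D} (h : IsState U ρ τ (B :: S))
    (hB : B.word = τ d :: (t ++ d :: r)) (ht : ∀ a ∈ t, τ a = a) :
    IsState U ρ (detach τ d)
      (⟨B.word, contract d (τ d) B.left, contract d (τ d) B.right⟩ :: S) := by
  have hBv := h.valid B (by simp)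
  have hn := h.nodup
  rw [List.flatMap_cons] at hn
  have hn1 := List.nodup_append.1 hn
  have hnB := hn1.1
  rw [hB] at hnB
  have he := (List.nodup_cons.1 hnB).1
  have hn2 := List.nodup_middle.1 (List.nodup_cons.1 hnB).2
  have hd1 := (List.nodup_cons.1 hn2).1
  simp only [List.mem_append, List.mem_cons, not_or] at he hd1
  have htr : ∀ a ∈ t, a ∉ r := fun a ha hm =>
    (List.nodup_append.1 (List.nodup_cons.1 hn2).2).2.2 a ha a hm rfl
  refine ⟨?_, by rw [List.flatMap_cons]; exact hn, fun a => by
    rw [List.flatMap_cons]; exact h.cover a⟩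
  intro X hX
  rcases List.mem_cons.1 hX with rfl | hX
  · refine ⟨hBv.cycle, ?_, indep_contract_detach hτ hBv.indep_left fun a => id,
      indep_contract_detach hτ hBv.indep_right fun a => id⟩
    have h1 : Transforms U ([τ d] ++ t ++ d :: r) B.left B.right := by
      have := hBv.transforms
      rwa [hB] at this
    -- Deleting the dead ends `t` makes `τ d` and `d` adjacent; after the contraction everything
    -- deleted is reinserted.
    have h2 := (Transforms.remove hU (fun a ha => hBv.indep_left a (Or.inr (ht a ha)))
      (fun a ha hm => by
        rcases List.mem_cons.1 hm with rfl | hm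
        · exact hd1.1 ha
        · exact htr a ha hm)).1 h1
    have h3 : Transforms U r _ _ := Transforms.contract hU h2 hd he.2.2 hd1.2
    rw [contract_comm hd, contract_comm hd] at h3
    have h4 := (Transforms.remove hU (u := []) (t := τ d :: (t ++ [d])) (v := r) (fun a ha => by
        simp only [List.mem_append, List.mem_cons, List.not_mem_nil, or_false] at ha
        rcases ha with rfl | ha | rfl
        · exact Indep.of_contract_right _ _ _
        · exact (hBv.indep_left a (Or.inr (ht a ha))).contract _ _
        · exact Indep.of_contract_left _ _ _) (fun a ha => by
        simp only [List.mem_append, List.mem_cons, List.not_mem_nil, or_false] at ha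
        rcases ha with rfl | ha | rfl
        · exact he.2.2
        · exact htr a ha
        · exact hd1.2)).2 h3
    simp only [hB]
    simpa using h4
  · have hX' : ∀ a ∈ X.word, a ∈ S.flatMap Block.word := fun a ha =>
      List.mem_flatMap.2 ⟨X, hX, ha⟩
    have h1 : d ∉ X.word := fun hm => hn1.2.2 d (by simp [hB]) d (hX' d hm) rfl
    have h2 : τ d ∉ X.word := fun hm => hn1.2.2 (τ d) (by simp [hB]) (τ d) (hX' _ hm) rfl
    exact (h.valid X (by simp [hX])).detach hτ h1 h2 fun a _ => rfl

theorem contract_mul_prod {d e : D} (F : (D → Fin q) → ℂ) (g : Block D q → (D → Fin q) → ℂ)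
    (hd : ∀ B ∈ S, Indep d (g B)) (he : ∀ B ∈ S, Indep e (g B)) :
    contract d e (fun σ => F σ * (S.map fun B => g B σ).prod)
      = fun σ => contract d e F σ * (S.map fun B => g B σ).prod :=
  contract_mul F _ (indep_prod hd) (indep_prod he)

/-- The left and the right tensors of a state of genus zero have the same total. -/
theorem total_left_eq_right [Fintype D] [Nontrivial A] (hU : IsQuantumPermutation U)
    (hτ : Function.Involutive τ) (hE : HasEulerBound ρ τ) (h : IsState U ρ τ S) :
    total τ (fun σ => (S.map fun B => B.left σ).prod)
      = total τ (fun σ => (S.map fun B => B.right σ).prod) := by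
  -- Induction on the number of live ends, for all rotations, involutions and states at once.
  induction hN : (Finset.univ.filter fun x => τ x ≠ x).card using Nat.strong_induction_on
    generalizing ρ τ S with
  | _ N ih =>
  have hlt : ∀ d, τ d ≠ d →
      (Finset.univ.filter fun x => detach τ d x ≠ x).card < N := by
    intro d hd
    rw [← hN]
    refine Finset.card_lt_card (Finset.ssubset_iff_of_subset ?_ |>.2 ⟨d, by simpa using hd, ?_⟩)
    · intro x hx
      simp only [Finset.mem_filter, Finset.mem_univ, true_and] at hx ⊢
      by_cases h1 : x = d
      · subst h1; exact hd
      by_cases h2 : x = τ d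
      · subst h2; exact absurd (detach_apply_apply hτ d) hx
      rwa [detach_apply_of_ne hτ h1 h2] at hx
    · simp [detach_apply_self]
  have hout : ∀ {B : Block D q} {S' : List (Block D q)}, IsState U ρ τ (B :: S') →
      ∀ a ∈ B.word, ∀ C ∈ S', a ∉ C.word := by
    intro B S' hS a ha C hC hm
    have hn := hS.nodup
    rw [List.flatMap_cons, List.nodup_append] at hn
    exact hn.2.2 a ha a (List.mem_flatMap.2 ⟨C, hC, hm⟩) rfl
  have hperm : ∀ {S' : List (Block D q)} (g : Block D q → (D → Fin q) → ℂ), S.Perm S' →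
      (fun σ => (S.map fun B => g B σ).prod) = fun σ => (S'.map fun B => g B σ).prod :=
    fun g hp => funext fun σ => (hp.map _).prod_eq
  by_cases hA : ∃ d, ¬ SameCycle ρ d (τ d)
  · obtain ⟨d, hd⟩ := hA
    have hd' : τ d ≠ d := fun h => hd (by rw [h])
    obtain ⟨B, S₁, hS₁, hdB⟩ := h.exists_cons d
    have h1 := h.perm hS₁
    obtain ⟨C, hC, hdC⟩ := List.mem_flatMap.1 (h1.cover (τ d))
    have hC : C ∈ S₁ := by
      rcases List.mem_cons.1 hC with rfl | hC
      · exact absurd ((h1.valid C List.mem_cons_self).cycle.sameCycle hdB hdC) hd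
      · exact hC
    obtain ⟨S₂, hS₂⟩ : ∃ S₂, S₁.Perm (C :: S₂) := by
      classical exact ⟨_, List.perm_cons_erase hC⟩
    have hp : S.Perm (B :: C :: S₂) := hS₁.trans (hS₂.cons B)
    have hp' : (B :: C :: S₂).Perm (C :: B :: S₂) := List.Perm.swap _ _ _
    have h2 := h.perm hp
    obtain ⟨u, u', hu⟩ := List.append_of_mem hdB
    obtain ⟨v, v', hv⟩ := List.append_of_mem hdC
    have h3 := (h2.rotate hU hu).perm (List.Perm.swap _ _ _)
    have h4 := (h3.rotate hU hv).perm (List.Perm.swap _ _ _)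
    have h5 := h4.contractEdge hU hτ rfl rfl
    have hdS : ∀ X ∈ S₂, d ∉ X.word := fun X hX =>
      hout h2 d hdB X (List.mem_cons_of_mem _ hX)
    have heS : ∀ X ∈ S₂, τ d ∉ X.word := fun X hX =>
      hout (h2.perm hp') (τ d) hdC X (List.mem_cons_of_mem _ hX)
    have h2v : ∀ X ∈ S₂, X.Valid U ρ τ := fun X hX => h2.valid X (by simp [hX])
    have h6 := ih _ (hlt d hd') (detach_involutive hτ d) (hE.contract hτ hd) h5 rfl
    rw [hperm _ hp, hperm _ hp]
    refine total_eq_of_contract hτ hd' ?_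
    simp only [List.map_cons, List.prod_cons, ← mul_assoc] at h6 ⊢
    rw [contract_mul_prod _ _ (fun X hX => (h2v X hX).indep_left d (Or.inl (hdS X hX)))
      (fun X hX => (h2v X hX).indep_left _ (Or.inl (heS X hX))),
      contract_mul_prod _ _ (fun X hX => (h2v X hX).indep_right d (Or.inl (hdS X hX)))
      (fun X hX => (h2v X hX).indep_right _ (Or.inl (heS X hX)))]
    exact h6
  push Not at hA
  by_cases hne : ∃ x, τ x ≠ x
  · obtain ⟨d, hd, hin⟩ := hE.exists_innermost hτ hA hne
    obtain ⟨B, S₁, hS₁, hdB⟩ := h.exists_cons (τ d)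
    have h1 := h.perm hS₁
    obtain ⟨u, v, huv⟩ := List.append_of_mem hdB
    have h2 := h1.rotate hU huv
    have hc := (h2.valid _ List.mem_cons_self).cycle
    have hdw : d ∈ τ d :: v ++ u :=
      hc.mem_of_sameCycle (by simp) (SameCycle.symm (hA d))
    rw [List.cons_append, List.mem_cons] at hdw
    obtain ⟨t, r, htr⟩ := List.append_of_mem (hdw.resolve_left hd.symm)
    have hn : (τ d :: (t ++ d :: r)).Nodup := by
      have := h2.nodup
      rw [List.flatMap_cons] at this
      rw [← htr]
      exact this.of_append_left
    have hdt : d ∉ t := fun hm =>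
      (List.nodup_cons.1 (List.nodup_middle.1 (List.nodup_cons.1 hn).2)).1
        (List.mem_append_left _ hm)
    have ht : ∀ a ∈ t, τ a = a := by
      refine fixed_of_innermost (x := τ d) hin ?_ ?_ hdt
      · change List.IsChain _ (τ d :: ((v ++ u) ++ [τ d])) at hc
        rw [htr, List.append_assoc, List.cons_append, List.isChain_cons_split] at hc
        exact hc.1
      · exact sameCycle_apply_right.2 (SameCycle.refl (ρ * τ) d)
    have h3 := h2.removeLoop hU hτ hd (t := t) (r := r) (by simp [htr]) ht
    have hφ : ¬ SameCycle (ρ * τ) d (τ d) := fun hs =>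
      hd (hin (τ d) (by rw [hτ d]; exact hd.symm) hs)
    have h6 := ih _ (hlt d hd) (detach_involutive hτ d) (hE.removeLoop hτ hd (hA d) hφ) h3 rfl
    have hdB' : d ∈ B.word := (h1.valid B List.mem_cons_self).cycle.mem_of_sameCycle hdB
      (SameCycle.symm (hA d))
    have h1v : ∀ X ∈ S₁, X.Valid U ρ τ := fun X hX => h1.valid X (by simp [hX])
    rw [hperm _ hS₁, hperm _ hS₁]
    refine total_eq_of_contract hτ hd ?_
    simp only [List.map_cons, List.prod_cons] at h6 ⊢
    rw [contract_mul_prod _ _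
        (fun X hX => (h1v X hX).indep_left d (Or.inl (hout h1 d hdB' X hX)))
        (fun X hX => (h1v X hX).indep_left _ (Or.inl (hout h1 _ hdB X hX))),
      contract_mul_prod _ _
        (fun X hX => (h1v X hX).indep_right d (Or.inl (hout h1 d hdB' X hX)))
        (fun X hX => (h1v X hX).indep_right _ (Or.inl (hout h1 _ hdB X hX)))]
    exact h6
  · push Not at hne
    -- With no live end, the left tensor is independent of every coordinate and `U` fixes it.
    -- Injectivity of `algebraMap`, valid as `A` is nontrivial, yields equality in `ℂ`.
    have heq : ∀ B ∈ S, B.left = B.right := by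
      intro B hB
      have hv := (h.valid B hB).transforms
      unfold Transforms at hv
      rw [act_of_indep hU fun a _ => ((h.valid B hB).indep_left a (Or.inr (hne a))).comp _] at hv
      funext x
      exact (algebraMap ℂ A).injective (congrFun hv x)
    congr 1
    funext σ
    congr 1
    exact List.map_congr_left fun B hB => by rw [heq B hB]

end Reduction

/-! ### Words given by enumerations of inputs. -/

section Words

variable {A : Type*} [CStarAlgebra A] {q : ℕ} {D : Type*}
  {U : Matrix (Fin q) (Fin q) A}

/-- The separate argument `x` of `H` serves the induction: the value at `e 0` becomes a parameter
while the remaining coordinates are acted on. -/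
theorem act_ofFn [DecidableEq D] {n : ℕ} {e : Fin n → D} (he : Function.Injective e)
    {H : (D → Fin q) → (Fin n → Fin q) → A} (hH : ∀ k y, Indep (e k) fun x => H x y)
    (x : D → Fin q) :
    act U (List.ofFn e) (fun x => H x (x ∘ e)) x
      = ∑ y, (List.ofFn fun k => U (x (e k)) (y k)).prod * H x y := by
  induction n generalizing x with
  | zero =>
    rw [Fintype.sum_unique]
    simp only [List.ofFn_zero, List.prod_nil, one_mul]
    exact congrArg (H x) (Subsingleton.elim _ _)
  | succ n ih =>
    have h1 : (fun x => H x (x ∘ e))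
        = fun x => H x (Fin.cons (x (e 0)) (x ∘ fun k => e (Fin.succ k))) := by
      funext x
      congr 1
      exact (Fin.cons_self_tail (x ∘ e)).symm
    have h2 := fun x => ih (e := fun k => e (Fin.succ k))
      (he.comp (Fin.succ_injective n)) (H := fun x y => H x (Fin.cons (x (e 0)) y))
      (fun k y x z => by
        have : e 0 ≠ e k.succ := fun h => (Fin.succ_ne_zero k) (he h).symm
        simp only [Function.update_of_ne this]
        exact hH k.succ _ x z) x
    rw [List.ofFn_succ, act_cons, h1]
    simp only [actAt, h2, Function.update_self]
    rw [← (Fin.consEquiv fun _ => Fin q).sum_comp, Fintype.sum_prod_type]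
    refine Finset.sum_congr rfl fun z _ => ?_
    rw [Finset.mul_sum]
    refine Finset.sum_congr rfl fun y _ => ?_
    have h3 : ∀ k : Fin n, Function.update x (e 0) z (e k.succ) = x (e k.succ) := fun k =>
      Function.update_of_ne (fun h => Fin.succ_ne_zero k (he h)) _ _
    have h4 := hH 0 (Fin.cons z y) x z
    simp only at h4
    simp only [h3, h4, List.ofFn_succ, List.prod_cons, Fin.consEquiv_apply, Fin.cons_zero,
      Fin.cons_succ, mul_assoc]
    rfl

theorem ofFn_rev {X : Type*} {n : ℕ} (g : Fin n → X) :
    (List.ofFn fun k => g k.rev) = (List.ofFn g).reverse := by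
  refine List.ext_getElem (by simp) fun i h1 h2 => ?_
  rw [List.getElem_reverse, List.getElem_ofFn, List.getElem_ofFn]
  congr 1
  ext
  simp only [List.length_ofFn] at h1 ⊢
  simp only [Fin.val_rev]
  omega

theorem isCycleWord_ofFn {ρ : Equiv.Perm D} {n : ℕ} {e : Fin n → D}
    (h : ∀ k, ρ (e k) = e (finRotate n k)) : IsCycleWord ρ (List.ofFn e) := by
  cases n with
  | zero => trivial
  | succ m =>
    rw [List.ofFn_succ]
    change List.IsChain _ ((e 0 :: List.ofFn fun k : Fin m => e k.succ) ++ [e 0])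
    rw [← List.ofFn_succ, List.isChain_iff_getElem]
    intro i hi
    simp only [List.length_append, List.length_ofFn, List.length_singleton] at hi
    have hi' : i < m + 1 := by omega
    rw [List.getElem_append_left (by simpa using hi'), List.getElem_ofFn, h]
    rcases Nat.lt_or_ge (i + 1) (m + 1) with h1 | h1
    · rw [List.getElem_append_left (by simpa using h1), List.getElem_ofFn]
      congr 1
      exact finRotate_of_lt (by omega)
    · have h2 : i = m := by omega
      subst h2
      rw [List.getElem_append_right (by simp)]
      simp only [List.getElem_singleton]
      congr 1
      exact finRotate_last

theorem finRotate_inv_rev {n : ℕ} (k : Fin n) : (finRotate n)⁻¹ k.rev = (finRotate n k).rev := by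
  cases n with
  | zero => exact k.elim0
  | succ m =>
    rw [Equiv.Perm.inv_eq_iff_eq, finRotate_apply, finRotate_apply, Fin.rev_add,
      sub_add_cancel]

end Words

/-! ### Reversing the order of the factors. -/

section Transform

variable {A : Type*} [CStarAlgebra A] {q : ℕ} {U : Matrix (Fin q) (Fin q) A}
  {ι : Type*} {n : ι → ℕ} {F G : ∀ i, Signature q (n i)}

theorem IsTransform.sum_eq (h : IsTransform U F G) (i : ι) (x : Fin (n i) → Fin q) :
    ∑ y, (List.ofFn fun k => U (x k) (y k)).prod * algebraMap ℂ A (F i y)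
      = algebraMap ℂ A (G i x) := congrFun (h i) x

theorem star_list_prod {R : Type*} [Monoid R] [StarMul R] (l : List R)
    (hl : ∀ a ∈ l, star a = a) : star l.prod = l.reverse.prod := by
  induction l with
  | nil => simp
  | cons a l ih =>
    rw [List.prod_cons, star_mul, ih fun b hb => hl b (List.mem_cons_of_mem _ hb),
      hl a List.mem_cons_self, List.reverse_cons, List.prod_append, List.prod_singleton]

/-- The conjugate of `F i` is some `F j`, and compatibility makes `G j` the conjugate of `G i`. The
adjoint of the relation for `j` reverses the self-adjoint factors and undoes both conjugations. -/
theorem IsTransform.sum_reverse_eq (hU : IsQuantumPermutation U) (h : IsTransform U F G)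
    (hFG : CompatibleConjClosed F G) (i : ι) (x : Fin (n i) → Fin q) :
    ∑ y, (List.ofFn fun k => U (x k) (y k)).reverse.prod * algebraMap ℂ A (F i y)
      = algebraMap ℂ A (G i x) := by
  obtain ⟨j, hj⟩ := (hFG.left_closed (n i) (F i)).1 ⟨i, rfl⟩
  have hj' := (hFG.conj_iff j i).1 hj
  -- The arity `m` is a variable so that the equality of dependent pairs can be substituted.
  have key : ∀ (m : ℕ) (F' G' : Signature q m),
      (⟨m, F'⟩ : Σ k : ℕ, Signature q k) = ⟨n i, (F i).conj⟩ →
      (⟨m, G'⟩ : Σ k : ℕ, Signature q k) = ⟨n i, (G i).conj⟩ →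
      (∀ x, ∑ y, (List.ofFn fun k => U (x k) (y k)).prod * algebraMap ℂ A (F' y)
        = algebraMap ℂ A (G' x)) →
      ∑ y, (List.ofFn fun k => U (x k) (y k)).prod * algebraMap ℂ A ((F i).conj y)
        = algebraMap ℂ A ((G i).conj x) := by
    intro m F' G' hF hG hs
    rw [Sigma.mk.injEq] at hF hG
    obtain ⟨rfl, hF⟩ := hF
    rw [eq_of_heq hF, eq_of_heq hG.2] at hs
    exact hs x
  have h1 := congrArg star (key _ _ _ hj hj' (h.sum_eq j))
  have hc : ∀ z : ℂ, star (algebraMap ℂ A (starRingEnd ℂ z)) = algebraMap ℂ A z := by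
    intro z
    rw [← algebraMap_star_comm, starRingEnd_apply, star_star]
  rw [star_sum] at h1
  simp only [Signature.conj, star_mul, hc, Algebra.commutes] at h1
  rw [← h1]
  refine Finset.sum_congr rfl fun y _ => ?_
  rw [star_list_prod]
  intro a ha
  obtain ⟨k, rfl⟩ := (List.mem_ofFn' _ _).1 ha
  exact hU.selfAdjoint _ _

end Transform

/-! ### From signature grids to states. -/

section Grid

variable {A : Type*} [CStarAlgebra A] {q : ℕ} {U : Matrix (Fin q) (Fin q) A}
  {ι : Type*} {n : ι → ℕ} {F G : ∀ i, Signature q (n i)} {V E : Type*}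

namespace SignatureGrid

theorem slot_symm_mate (Ω : SignatureGrid n V E) (x : Σ v : V, Fin (n (Ω.lab v))) :
    Ω.slot.symm (Ω.mate x) = ((Ω.slot.symm x).1, !(Ω.slot.symm x).2) := by
  simp only [mate, Equiv.trans_apply, Equiv.symm_apply_apply]
  rfl

theorem mate_involutive (Ω : SignatureGrid n V E) : Function.Involutive Ω.mate := by
  intro x
  apply Ω.slot.symm.injective
  rw [slot_symm_mate, slot_symm_mate, Bool.not_not]

/-- There are two ends per edge, and `mate` preserves the underlying edge, so it has at least one
orbit per edge. This direction suffices for the inequality. -/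
theorem hasEulerBound [Finite V] [Finite E] (Ω : SignatureGrid n V E) (ccw : V → Bool)
    (h : IsPlanarMap (Ω.rotation ccw) Ω.mate) : HasEulerBound (Ω.rotation ccw) Ω.mate := by
  have h1 : Nat.card E ≤ orbitCount Ω.mate := by
    refine Nat.card_le_card_of_injective
      (fun e => Quotient.mk (SameCycle.setoid Ω.mate) (Ω.slot (e, false))) ?_
    intro e e' he
    have hle : SameCycle.setoid Ω.mate ≤ Setoid.ker fun x => (Ω.slot.symm x).1 :=
      setoid_le_of_forall_apply fun x => by
        change (Ω.slot.symm x).1 = (Ω.slot.symm (Ω.mate x)).1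
        rw [slot_symm_mate]
    have h2 : (Ω.slot.symm (Ω.slot (e, false))).1 = (Ω.slot.symm (Ω.slot (e', false))).1 :=
      hle (Quotient.exact he)
    simpa using h2
  have h2 : Nat.card (Σ v : V, Fin (n (Ω.lab v))) = Nat.card E * 2 := by
    rw [← Nat.card_congr Ω.slot, Nat.card_prod]
    simp
  unfold IsPlanarMap at h
  unfold HasEulerBound
  simp only [orbitCount] at h1 ⊢
  omega

theorem holant_eq_total [Fintype V] [Fintype E] [DecidableEq E] (Ω : SignatureGrid n V E)
    [DecidableEq (Σ v : V, Fin (n (Ω.lab v)))] (F : ∀ i, Signature q (n i)) :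
    Ω.holant F = total Ω.mate fun x => ∏ v, F (Ω.lab v) fun k => x ⟨v, k⟩ := by
  unfold holant total
  refine Finset.sum_nbij' (fun σ x => σ (Ω.slot.symm x).1) (fun x e => x (Ω.slot (e, false)))
    ?_ ?_ ?_ ?_ ?_
  · intro σ _
    simp only [Finset.mem_filter, Finset.mem_univ, true_and]
    intro a
    rw [slot_symm_mate]
  · simp
  · intro σ _
    simp
  · intro x hx
    simp only [Finset.mem_filter, Finset.mem_univ, true_and] at hx
    funext a
    obtain ⟨⟨e, b⟩, rfl⟩ := Ω.slot.surjective a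
    simp only [Equiv.symm_apply_apply]
    cases b with
    | false => rfl
    | true =>
      rw [← hx (Ω.slot (e, true))]
      congr 1
      apply Ω.slot.symm.injective
      rw [slot_symm_mate]
      simp
  · intro σ _
    rfl

/-- The inputs at `v` in counterclockwise cyclic order. -/
def ccwInput (Ω : SignatureGrid n V E) (ccw : V → Bool) (v : V) (k : Fin (n (Ω.lab v))) :
    Σ v : V, Fin (n (Ω.lab v)) :=
  ⟨v, if ccw v then k else k.rev⟩

theorem ccwInput_injective (Ω : SignatureGrid n V E) (ccw : V → Bool) (v : V) :
    Function.Injective (Ω.ccwInput ccw v) := by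
  intro k l h
  simp only [ccwInput, Sigma.mk.injEq, heq_eq_eq, true_and] at h
  split_ifs at h
  · exact h
  · exact Fin.rev_injective h

theorem rotation_ccwInput (Ω : SignatureGrid n V E) (ccw : V → Bool) (v : V)
    (k : Fin (n (Ω.lab v))) :
    Ω.rotation ccw (Ω.ccwInput ccw v k) = Ω.ccwInput ccw v (finRotate _ k) := by
  change (⟨v, (if ccw v then finRotate (n (Ω.lab v)) else (finRotate (n (Ω.lab v)))⁻¹) _⟩ :
    Σ v : V, Fin (n (Ω.lab v))) = ⟨v, _⟩
  congr 1
  simp only [ccwInput]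
  split_ifs
  · rfl
  · exact finRotate_inv_rev k

theorem mem_ofFn_ccwInput (Ω : SignatureGrid n V E) (ccw : V → Bool) (v : V)
    (x : Σ v : V, Fin (n (Ω.lab v))) :
    x ∈ List.ofFn (Ω.ccwInput ccw v) ↔ x.1 = v := by
  rw [List.mem_ofFn']
  constructor
  · rintro ⟨k, rfl⟩; rfl
  · obtain ⟨v', k⟩ := x
    rintro rfl
    by_cases h : ccw v' = true
    · exact ⟨k, by simp [ccwInput, h]⟩
    · exact ⟨k.rev, by simp [ccwInput, h]⟩

/-- The vertex `v` as a block. -/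
def block (Ω : SignatureGrid n V E) (ccw : V → Bool) (F G : ∀ i, Signature q (n i)) (v : V) :
    Block (Σ v : V, Fin (n (Ω.lab v))) q where
  word := List.ofFn (Ω.ccwInput ccw v)
  left x := F (Ω.lab v) fun k => x ⟨v, k⟩
  right x := G (Ω.lab v) fun k => x ⟨v, k⟩

theorem transforms_block (hU : IsQuantumPermutation U) (hUF : IsTransform U F G)
    (hFG : CompatibleConjClosed F G) (Ω : SignatureGrid n V E)
    [DecidableEq (Σ v : V, Fin (n (Ω.lab v)))] (ccw : V → Bool) (v : V) :
    Transforms U (Ω.block ccw F G v).word (Ω.block ccw F G v).left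
      (Ω.block ccw F G v).right := by
  funext x
  have hinj := Ω.ccwInput_injective ccw v
  simp only [block]
  by_cases h : ccw v = true
  · rw [← hUF.sum_eq]
    have := act_ofFn (U := U) hinj (H := fun _ y => algebraMap ℂ A (F (Ω.lab v) y))
      (fun _ _ _ _ => rfl) x
    simpa [ccwInput, h, Function.comp_def] using this
  -- At a clockwise vertex the word lists the inputs backwards, so the reversed product is the one
  -- that occurs.
  · rw [← hUF.sum_reverse_eq hU hFG]
    have := act_ofFn (U := U) hinj
      (H := fun _ y => algebraMap ℂ A (F (Ω.lab v) fun k => y k.rev)) (fun _ _ _ _ => rfl) x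
    rw [← (Equiv.arrowCongr Fin.revPerm (Equiv.refl (Fin q))).sum_comp] at this
    simp only [← ofFn_rev]
    simpa [ccwInput, h, Function.comp_def] using this

theorem isState (hU : IsQuantumPermutation U) (hUF : IsTransform U F G)
    (hFG : CompatibleConjClosed F G) [Fintype V] (Ω : SignatureGrid n V E)
    [DecidableEq (Σ v : V, Fin (n (Ω.lab v)))] (ccw : V → Bool) :
    IsState U (Ω.rotation ccw) Ω.mate
      ((Finset.univ : Finset V).toList.map (Ω.block ccw F G)) := by
  have hindep : ∀ (H : ∀ i, Signature q (n i)) (v : V) (a : Σ v : V, Fin (n (Ω.lab v))),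
      a ∉ List.ofFn (Ω.ccwInput ccw v) ∨ Ω.mate a = a →
      Indep a fun x : (Σ v : V, Fin (n (Ω.lab v))) → Fin q =>
        H (Ω.lab v) fun k => x ⟨v, k⟩ := by
    intro H v a ha x z
    have ha' : a.1 ≠ v := by
      rcases ha with ha | ha
      · rwa [mem_ofFn_ccwInput] at ha
      -- `mate` flips the Boolean that tells the two ends of an edge apart, so initially there are
      -- no fixed points.
      · have := congrArg (fun y => (Ω.slot.symm y).2) ha
        simp [slot_symm_mate] at this
    simp only
    congr 1
    funext k
    exact Function.update_of_ne (fun h => ha' (congrArg Sigma.fst h).symm) _ _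
  refine ⟨?_, ?_, ?_⟩
  · intro B hB
    obtain ⟨v, _, rfl⟩ := List.mem_map.1 hB
    exact ⟨isCycleWord_ofFn (Ω.rotation_ccwInput ccw v), transforms_block hU hUF hFG Ω ccw v,
      hindep F v, hindep G v⟩
  · rw [List.flatMap_map, List.nodup_flatMap]
    refine ⟨fun v _ => List.nodup_ofFn.2 (Ω.ccwInput_injective ccw v), ?_⟩
    refine (Finset.nodup_toList _).imp fun {v w} hvw x hx hx' => hvw ?_
    exact ((Ω.mem_ofFn_ccwInput ccw v x).1 hx).symm.trans ((Ω.mem_ofFn_ccwInput ccw w x).1 hx')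
  · intro a
    rw [List.flatMap_map, List.mem_flatMap]
    exact ⟨a.1, by simp, (Ω.mem_ofFn_ccwInput ccw a.1 a).2 rfl⟩

end SignatureGrid

end Grid

end QuantumHolant

theorem mainTheorem2 {A : Type*} [CStarAlgebra A] [Nontrivial A] {q : ℕ}
    (U : Matrix (Fin q) (Fin q) A) (hU : QuantumHolant.IsQuantumPermutation U)
    {ι : Type*} {n : ι → ℕ} (F G : ∀ i, QuantumHolant.Signature q (n i))
    (hUF : QuantumHolant.IsTransform U F G)
    (hFG : QuantumHolant.CompatibleConjClosed F G)
    {V E : Type*} [Fintype V] [Fintype E] [DecidableEq E]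
    (Ω : QuantumHolant.SignatureGrid n V E) (hΩ : Ω.IsPlanar) :
    Ω.holant F = Ω.holant G := by
  classical
  obtain ⟨ccw, h⟩ := hΩ
  have key := QuantumHolant.total_left_eq_right hU Ω.mate_involutive (Ω.hasEulerBound ccw h)
    (QuantumHolant.SignatureGrid.isState hU hUF hFG Ω ccw)
  simp only [List.map_map, Function.comp_def, Finset.prod_map_toList] at key
  rw [Ω.holant_eq_total, Ω.holant_eq_total]
  exact key
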